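/- **Setting.** Let $f(x)=\frac{1+ix}{1-ix}$ be the Cayley function. For every security parameter $\lambda\in\mathbb N$ fix a circuit architecture with $m=m(\lambda)\ge 1$ gate positions on $n=n(\lambda)$ qubits, each gate acting on one or two given qubits (a fixed architecture is the case where nothing depends on $\lambda$), and a number of parties $p=p(\lambda)\ge m$. The circuits $C=(C_1,\dots,C_m)$ to be shared are all circuits of this architecture, with arbitrary unitary gates. For independent Haar random gates $H_k=f(h_k)$, $h_k$ Hermitian, of the same sizes, the Cayley path of $C$ is the circuit $C(\theta)$ with gates $C_k(\theta)=C_k f(\theta h_k)$. The Cayley-path scheme with parameters $\Delta:\mathbb N\to\mathbb R$ and $\ell:\mathbb N\to\mathbb N$ is: $\mathsf{Gen}(1^\lambda,C)$ draws $H_1,\dots,H_m$ and outputs the shares $C_i=C(1-i\Delta(\lambda))$, $i=1,\dots,p$ (lists of gates, all for the same $H_k$); $\mathsf{Eval}$ runs $C_i$ on each of $\ell$ copies of $|\psi\rangle$, measures $\{\Pi,I-\Pi\}$ and outputs the frequency $y_i$ of the outcome $\Pi$; $\mathsf{Rec}$ outputs the value at $0$ of the Lagrange interpolation polynomial through the points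 $(1-i\Delta(\lambda),y_i)$. In the indistinguishability game for a set $T$ of corrupted parties, an (unbounded) adversary chooses two circuits $C^0,C^1$, receives the shares of the parties in $T$ of $C^b$ for a uniform bit $b$, and outputs a guess $b'$; its advantage is $|\Pr[b'=b]-\frac12|$. A scheme is $t$-secure if for all $T=T(\lambda)$ with $|T|\le t$ all adversaries have advantage negligible in $\lambda$. A scheme is a $(p,t,\ell,\mathcal T,\eta)$ QFSS scheme if it is $t$-secure, it is correct (for all $C$, unit vectors $|\psi\rangle$ and projectors $\Pi$, the reconstructed value is within $\eta$ of $\|\Pi C|\psi\rangle\|^2$ with probability $\ge 1-\mathrm{negl}(\lambda)$, uniformly), $\mathsf{Eval}$ uses at most $\ell$ copies of $|\psi\rangle$ and time (number of gates applied) at most $\mathcal T$, and $\mathsf{Rec}$ takes time $\mathrm{poly}(\lambda,p)$ (number of arithmetic steps). **Statement.** There are absolute constants $c,K>0$ such that, whenever $\Delta=1/\mathrm{poly}(\lambda)$, i.e. $\lambda^{-k}\le\Delta(\lambda)\le 1$ for some $k$ and all large $\lambda$, and for all $\ell:\mathbb N\to\mathbb N$ and $\eta:\mathbb N\to\mathbb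 R$: 1. For all $\lambda$ and all $i\le p$ with $0\le i\Delta(\lambda)\le 1$, the optimal (supremal) advantage $\mathrm{Adv}_i(\lambda)$ of an adversary that sees only the share $C_i$ satisfies $c\,i\Delta(\lambda)\le \mathrm{Adv}_i(\lambda)\le K\,m\,i\Delta(\lambda)$. In particular, if $m(\lambda)$ is bounded (for instance, if the architecture is fixed), then $\mathrm{Adv}_i=\Theta(m\Delta)$ as $\lambda\to\infty$, for every fixed party $i$ (with $i\le p(\lambda)$ for all $\lambda$ and $i\Delta(\lambda)\le1$ for all large $\lambda$). 2. For every choice of a single party $i=i(\lambda)\le p(\lambda)$ with $i\Delta\le 1$ for all large $\lambda$, some adversary that sees only the share $C_i$ has non-negligible advantage. 3. Hence the scheme is not $1$-secure, and $(\mathsf{Gen},\mathsf{Eval},\mathsf{Rec})$ is not a $(p,1,\ell,|C|\ell,\eta)$ QFSS scheme, where $|C|=m$. -/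

import Mathlib

open MeasureTheory ProbabilityTheory Filter Asymptotics
open scoped ENNReal

namespace QFSS

noncomputable section

/-! ### The Cayley path between unitary matrices -/

section Cayley

variable {ι : Type*} [Fintype ι] [DecidableEq ι]

/-- The Cayley function `f(A) = (1 + iA) / (1 - iA)` of a square matrix. -/
def cayley (A : Matrix ι ι ℂ) : Matrix ι ι ℂ :=
  (1 + Complex.I • A) * (1 - Complex.I • A)⁻¹

/-- The inverse Cayley function `f⁻¹(U) = i (1 - U) / (1 + U)`. For a unitary `U` without the
eigenvalue `-1` (hence for Haar almost every `U`) this is the unique Hermitian `h` with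
`f(h) = U`; on the exceptional null set Mathlib's matrix inverse makes it `0`. -/
def invCayley (U : Matrix ι ι ℂ) : Matrix ι ι ℂ :=
  Complex.I • ((1 - U) * (1 + U)⁻¹)

theorem invCayley_isHermitian (H : Matrix.unitaryGroup ι ℂ) :
    (invCayley (H : Matrix ι ι ℂ)).IsHermitian := by
  by_cases hu : IsUnit (1 + (H : Matrix ι ι ℂ)).det
  · set U : Matrix ι ι ℂ := (H : Matrix ι ι ℂ) with hU
    have h1 : U * U.conjTranspose = 1 := Matrix.mem_unitaryGroup_iff.1 H.2
    have h2 : U.conjTranspose * U = 1 := Matrix.mem_unitaryGroup_iff'.1 H.2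
    have hu' : IsUnit (1 + U.conjTranspose).det := by
      have : (1 + U.conjTranspose) = (1 + U).conjTranspose := by simp
      rw [this, Matrix.det_conjTranspose]
      exact hu.star
    unfold Matrix.IsHermitian invCayley
    rw [Matrix.conjTranspose_smul, Matrix.conjTranspose_mul, Matrix.conjTranspose_nonsing_inv]
    simp only [Matrix.conjTranspose_sub, Matrix.conjTranspose_add, Matrix.conjTranspose_one]
    have key : (1 - U.conjTranspose) * (1 + U) = -((1 + U.conjTranspose) * (1 - U)) := by
      simp only [sub_mul, mul_add, add_mul, mul_sub, h2, one_mul, mul_one]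
      abel
    have : (1 + U.conjTranspose)⁻¹ * (1 - U.conjTranspose) = -((1 - U) * (1 + U)⁻¹) := by
      calc (1 + U.conjTranspose)⁻¹ * (1 - U.conjTranspose)
          = (1 + U.conjTranspose)⁻¹ * ((1 - U.conjTranspose) * (1 + U)) * (1 + U)⁻¹ := by
            rw [Matrix.mul_assoc, Matrix.mul_assoc, Matrix.mul_nonsing_inv _ hu, mul_one]
        _ = -((1 - U) * (1 + U)⁻¹) := by
            rw [key, Matrix.mul_neg, ← Matrix.mul_assoc, Matrix.nonsing_inv_mul _ hu', one_mul,
              Matrix.neg_mul]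
    rw [this]
    simp
  · have : invCayley (H : Matrix ι ι ℂ) = 0 := by
      unfold invCayley
      rw [Matrix.nonsing_inv_apply_not_isUnit _ hu]
      simp
    rw [this]
    exact Matrix.isHermitian_zero

open scoped ComplexOrder in
theorem cayley_mem_unitaryGroup {A : Matrix ι ι ℂ} (hA : A.IsHermitian) :
    cayley A ∈ Matrix.unitaryGroup ι ℂ := by
  set B : Matrix ι ι ℂ := 1 + Complex.I • A with hB
  set D : Matrix ι ι ℂ := 1 - Complex.I • A with hD
  have hBs : B.conjTranspose = D := by
    simp [hB, hD, Matrix.conjTranspose_smul, hA.eq, sub_eq_add_neg]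
  have hDs : D.conjTranspose = B := by
    rw [← hBs, Matrix.conjTranspose_conjTranspose]
  have hcomm : B * D = D * B := by
    simp only [hB, hD, mul_sub, mul_add, sub_mul, add_mul, one_mul, mul_one]
    abel
  have hpos : (B * D).PosDef := by
    have e : B * D = 1 + A.conjTranspose * A := by
      simp only [hB, hD, hA.eq, mul_sub, add_mul, one_mul, mul_one, Matrix.smul_mul,
        Matrix.mul_smul, smul_smul, Complex.I_mul_I, neg_smul, one_smul]
      abel
    rw [e]
    exact Matrix.PosDef.one.add_posSemidef (Matrix.posSemidef_conjTranspose_mul_self A)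
  have hdet : IsUnit (B * D).det := (Matrix.isUnit_iff_isUnit_det _).1 hpos.isUnit
  rw [Matrix.det_mul] at hdet
  have hBu : IsUnit B.det := isUnit_of_mul_isUnit_left hdet
  have hDu : IsUnit D.det := isUnit_of_mul_isUnit_right hdet
  rw [Matrix.mem_unitaryGroup_iff']
  change (B * D⁻¹).conjTranspose * (B * D⁻¹) = 1
  rw [Matrix.conjTranspose_mul, Matrix.conjTranspose_nonsing_inv, hBs, hDs]
  calc B⁻¹ * D * (B * D⁻¹) = B⁻¹ * (D * B) * D⁻¹ := by simp only [Matrix.mul_assoc]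
    _ = (B⁻¹ * B) * (D * D⁻¹) := by rw [← hcomm]; simp only [Matrix.mul_assoc]
    _ = 1 := by rw [Matrix.nonsing_inv_mul _ hBu, Matrix.mul_nonsing_inv _ hDu, one_mul]

/-- `f(θ h)`, where `h = f⁻¹(H)`. -/
def cayleyPath (θ : ℝ) (H : Matrix.unitaryGroup ι ℂ) : Matrix.unitaryGroup ι ℂ :=
  ⟨cayley ((θ : ℂ) • invCayley (H : Matrix ι ι ℂ)), cayley_mem_unitaryGroup (by
    have h := invCayley_isHermitian H
    unfold Matrix.IsHermitian at h ⊢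
    rw [Matrix.conjTranspose_smul, h]
    simp)⟩

end Cayley

/-! ### Haar measure on the unitary group -/

section Haar

variable (ι : Type*) [Fintype ι] [DecidableEq ι]

instance : MeasurableSpace (Matrix.unitaryGroup ι ℂ) := borel _

instance : BorelSpace (Matrix.unitaryGroup ι ℂ) := ⟨rfl⟩

instance : CompactSpace (Matrix.unitaryGroup ι ℂ) := by
  apply isCompact_iff_compactSpace.1
  have hc : IsCompact (Set.univ.pi fun _ : ι => Set.univ.pi fun _ : ι =>
      Metric.closedBall (0 : ℂ) 1) :=
    isCompact_univ_pi fun _ => isCompact_univ_pi fun _ => isCompact_closedBall _ _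
  refine IsCompact.of_isClosed_subset (s := (Set.univ.pi fun _ : ι => Set.univ.pi fun _ : ι =>
    Metric.closedBall (0 : ℂ) 1 : Set (Matrix ι ι ℂ))) hc ?_ ?_
  · have : ((Matrix.unitaryGroup ι ℂ : Submonoid (Matrix ι ι ℂ)) : Set (Matrix ι ι ℂ))
        = {A | A * star A = 1} := by
      ext A
      exact Matrix.mem_unitaryGroup_iff
    rw [this]
    exact isClosed_eq (by fun_prop) continuous_const
  · intro A hA i _ j _
    simpa using entry_norm_bound_of_unitary hA i j

/-- The Haar probability measure on the unitary group. -/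
def haarUnitary : Measure (Matrix.unitaryGroup ι ℂ) :=
  Measure.haarMeasure ⊤

end Haar

/-! ### Quantum circuits -/

/-- A circuit architecture: `n` qubits and `m` gate positions, the `k`-th gate acting on the one or
two qubits in `site k`. -/
structure Architecture where
  n : ℕ
  m : ℕ
  site : Fin m → Finset (Fin n)
  site_card : ∀ k, (site k).card = 1 ∨ (site k).card = 2

/-- Unitary gates on the qubits in `S` (matrices in the computational basis). -/
abbrev Gate {n : ℕ} (S : Finset (Fin n)) : Type :=
  Matrix.unitaryGroup (S → Fin 2) ℂ

/-- A (description of a) circuit with architecture `A`: the list of its gates. -/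
abbrev Architecture.Circuit (A : Architecture) : Type :=
  ∀ k : Fin A.m, Gate (A.site k)

/-- State vectors of `n` qubits. -/
abbrev Register (n : ℕ) : Type :=
  EuclideanSpace ℂ (Fin n → Fin 2)

/-- Operators on `n` qubits. -/
abbrev Operator (n : ℕ) : Type :=
  Matrix (Fin n → Fin 2) (Fin n → Fin 2) ℂ

/-- The operator `U ⊗ I` on `n` qubits, `U` acting on the qubits in `S`. -/
def liftGate {n : ℕ} {S : Finset (Fin n)} (U : Gate S) : Operator n :=
  Matrix.of fun x y =>
    if ∀ j, j ∉ S → x j = y j then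
      (U : Matrix (S → Fin 2) (S → Fin 2) ℂ) (fun j => x j) (fun j => y j)
    else 0

/-- The unitary `C = (C_m ⊗ I) ⋯ (C_1 ⊗ I)` of a circuit. -/
def Architecture.Circuit.toOperator {A : Architecture} (C : A.Circuit) : Operator A.n :=
  ((List.finRange A.m).map fun k => liftGate (C k)).reverse.prod

/-- `f_C(ψ, Π) = ‖Π C ψ‖²`. -/
def outputProb {A : Architecture} (C : A.Circuit) (ψ : Register A.n) (P : Operator A.n) : ℝ :=
  ‖Matrix.toEuclideanLin (P * C.toOperator) ψ‖ ^ 2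

/-! ### Evaluation: quantum programs using copies of the input state -/

/-- Programs of a party that holds an `n`-qubit register: load a fresh copy of the input state,
apply a gate, measure the register with `{Π, I - Π}` (`true` is the outcome `Π`), or stop with an
output. -/
inductive Program (n : ℕ) : Type
  | output (y : ℝ) : Program n
  | newCopy (next : Program n) : Program n
  | gate (S : Finset (Fin n)) (U : Gate S) (next : Program n) : Program n
  | measure (next : Bool → Program n) : Program n

namespace Program

variable {n : ℕ}

/-- The law of the output of a program, on input state `ψ` and projector `P`, when the register
is in state `φ`. -/
def lawFrom (ψ : Register n) (P : Operator n) : Program n → Register n → Measure ℝ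
  | output y, _ => Measure.dirac y
  | newCopy next, _ => lawFrom ψ P next ψ
  | gate _ U next, φ => lawFrom ψ P next (Matrix.toEuclideanLin (liftGate U) φ)
  | measure next, φ =>
      let φ₁ : Register n := Matrix.toEuclideanLin P φ
      let φ₀ : Register n := Matrix.toEuclideanLin (1 - P) φ
      ENNReal.ofReal (‖φ₁‖ ^ 2) • lawFrom ψ P (next true) (((‖φ₁‖ : ℂ)⁻¹) • φ₁)
        + ENNReal.ofReal (‖φ₀‖ ^ 2) • lawFrom ψ P (next false) (((‖φ₀‖ : ℂ)⁻¹) • φ₀)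

/-- The law of the output, the register being initialised to `|0…0⟩`. -/
def law (Q : Program n) (ψ : Register n) (P : Operator n) : Measure ℝ :=
  Q.lawFrom ψ P (EuclideanSpace.single 0 1)

/-- The number of copies of the input state used (in the worst case). -/
def copies : Program n → ℕ
  | output _ => 0
  | newCopy next => next.copies + 1
  | gate _ _ next => next.copies
  | measure next => max (next true).copies (next false).copies

/-- The running time: the number of gates applied (in the worst case). -/
def time : Program n → ℕ
  | output _ => 0
  | newCopy next => next.time
  | gate _ _ next => next.time + 1
  | measure next => max (next true).time (next false).time

end Program

/-! ### Reconstruction: arithmetic expressions -/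

/-- Arithmetic expressions in the real inputs `y_1, …, y_p`. -/
inductive ArithExpr (p : ℕ) : Type
  | const (r : ℝ) : ArithExpr p
  | input (i : Fin p) : ArithExpr p
  | add (a b : ArithExpr p) : ArithExpr p
  | sub (a b : ArithExpr p) : ArithExpr p
  | mul (a b : ArithExpr p) : ArithExpr p
  | div (a b : ArithExpr p) : ArithExpr p

namespace ArithExpr

variable {p : ℕ}

def eval (y : Fin p → ℝ) : ArithExpr p → ℝ
  | const r => r
  | input i => y i
  | add a b => a.eval y + b.eval y
  | sub a b => a.eval y - b.eval y
  | mul a b => a.eval y * b.eval y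
  | div a b => a.eval y / b.eval y

/-- The running time: one step for each constant, input and arithmetic operation. -/
def time : ArithExpr p → ℕ
  | const _ => 1
  | input _ => 1
  | add a b => a.time + b.time + 1
  | sub a b => a.time + b.time + 1
  | mul a b => a.time + b.time + 1
  | div a b => a.time + b.time + 1

def sum (l : List (ArithExpr p)) : ArithExpr p := l.foldr add (const 0)

def prod (l : List (ArithExpr p)) : ArithExpr p := l.foldr mul (const 1)

/-- `F(0)`, where `F` is the Lagrange interpolation polynomial through the points
`(θ i, y_i)`. -/
def lagrangeAtZero (θ : Fin p → ℝ) : ArithExpr p :=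
  sum ((List.finRange p).map fun i =>
    mul (input i) (prod (((List.finRange p).filter (· ≠ i)).map fun j =>
      div (sub (const 0) (const (θ j))) (sub (const (θ i)) (const (θ j))))))

end ArithExpr

/-! ### Quantum function secret sharing -/

/-- Negligible functions of the security parameter. -/
def Negligible (f : ℕ → ℝ) : Prop :=
  SuperpolynomialDecay atTop (fun sec : ℕ => (sec : ℝ)) f

/-- `Δ = 1 / poly`: the function `1 / Δ` is at least `1` and bounded by a polynomial in the security
parameter (for all large values of the parameter). -/
def InversePoly (Δ : ℕ → ℝ) : Prop :=
  ∃ k : ℕ, ∀ᶠ sec : ℕ in atTop, 1 / (sec : ℝ) ^ k ≤ Δ sec ∧ Δ sec ≤ 1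

/-- The algorithms `(Gen, Eval, Rec)` of a function sharing scheme for the circuits with
architecture `A sec` and for `p sec` parties, where `sec` is the security parameter. `gen` gives the
joint law of the shares, `eval` the program that a party runs on its share, and `recon` the
reconstruction of the result from the outputs of the parties. -/
structure Scheme (A : ℕ → Architecture) (p : ℕ → ℕ) where
  Share : (sec : ℕ) → Fin (p sec) → Type
  [measurableShare : ∀ sec i, MeasurableSpace (Share sec i)]
  gen : (sec : ℕ) → (A sec).Circuit → Measure (∀ i, Share sec i)
  eval : (sec : ℕ) → (i : Fin (p sec)) → Share sec i → Program (A sec).n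
  recon : (sec : ℕ) → ArithExpr (p sec)

attribute [instance] Scheme.measurableShare

namespace Scheme

variable {A : ℕ → Architecture} {p : ℕ → ℕ} (S : Scheme A p)

/-- The probability, over `Gen` and the parties' evaluations, that `Rec` gives `‖Π C ψ‖²` up to an
error `η`. -/
def successProb (sec : ℕ) (C : (A sec).Circuit) (ψ : Register (A sec).n) (P : Operator (A sec).n)
    (η : ℝ) : ℝ≥0∞ :=
  ∫⁻ s, Measure.pi (fun i => (S.eval sec i (s i)).law ψ P)
    {y | |(S.recon sec).eval y - outputProb C ψ P| ≤ η} ∂(S.gen sec C)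

/-- Correctness with precision `η`: up to a negligible probability, the value is recovered. -/
def Correct (η : ℕ → ℝ) : Prop :=
  ∃ ν : ℕ → ℝ, Negligible ν ∧
    ∀ (sec : ℕ) (C : (A sec).Circuit) (ψ : Register (A sec).n) (P : Operator (A sec).n),
      ‖ψ‖ = 1 → IsStarProjection P →
        ENNReal.ofReal (1 - ν sec) ≤ S.successProb sec C ψ P (η sec)

/-- A computationally unbounded adversary in the indistinguishability game with corrupted parties
`T`: it outputs two circuits `circ false` (that is, `C⁰`) and `circ true` (`C¹`), and then makes a
randomized guess upon the shares of the parties in `T`. -/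
structure Adversary (sec : ℕ) (T : Finset (Fin (p sec))) where
  circ : Bool → (A sec).Circuit
  guess : Kernel (∀ i : T, S.Share sec i) Bool
  [isMarkov : IsMarkovKernel guess]

variable {S} in
/-- The law of the output `b ⊕ b'` of the game: `b` is a uniform bit, the shares of the circuit
`circ b` are generated, and `b'` is the adversary's guess on the shares of the parties in `T`. -/
def Adversary.game {sec : ℕ} {T : Finset (Fin (p sec))} (𝒜 : S.Adversary sec T) : Measure Bool :=
  (2⁻¹ : ℝ≥0∞) • ∑ b : Bool,
    (((S.gen sec (𝒜.circ b)).map T.restrict).bind 𝒜.guess).map (fun b' => xor b b')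

variable {S} in
/-- `|Pr(game outputs 0) - 1/2|`. -/
def Adversary.advantage {sec : ℕ} {T : Finset (Fin (p sec))} (𝒜 : S.Adversary sec T) : ℝ :=
  |𝒜.game.real {false} - 1 / 2|

/-- The optimal advantage of an adversary that corrupts the parties in `T`. -/
def optAdvantage (sec : ℕ) (T : Finset (Fin (p sec))) : ℝ :=
  ⨆ 𝒜 : S.Adversary sec T, 𝒜.advantage

/-- Statistical security against `t` corrupted parties. -/
def Secure (t : ℕ) : Prop :=
  ∀ T : (sec : ℕ) → Finset (Fin (p sec)), (∀ sec, (T sec).card ≤ t) →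
    ∀ 𝒜 : (sec : ℕ) → S.Adversary sec (T sec), Negligible fun sec => (𝒜 sec).advantage

/-- `(p, t, ℓ, T, η)` quantum function secret sharing: `Eval` uses at most `ℓ` copies of the input
state and time at most `T`, `Rec` runs in polynomial time in the security parameter and the number
of parties, and correctness and security hold. -/
structure IsQFSS (t : ℕ) (ℓ T : ℕ → ℕ) (η : ℕ → ℝ) : Prop where
  eval_copies : ∀ sec i s, (S.eval sec i s).copies ≤ ℓ sec
  eval_time : ∀ sec i s, (S.eval sec i s).time ≤ T sec
  recon_time : ∃ k : ℕ, ∀ sec, (S.recon sec).time ≤ (sec + p sec + 2) ^ k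
  correct : S.Correct η
  secure : S.Secure t

end Scheme

/-! ### The scheme from Cayley paths -/

/-- The circuit `C(θ)` on the Cayley path, with gates `C_k(θ) = C_k f(θ h_k)`, `H_k = f(h_k)`. -/
def cayleyCircuit {A : Architecture} (C H : A.Circuit) (θ : ℝ) : A.Circuit :=
  fun k => C k * cayleyPath θ (H k)

/-- The law of circuits with independent Haar random gates. -/
def haarCircuit (A : Architecture) : Measure A.Circuit :=
  Measure.pi fun k => haarUnitary (A.site k → Fin 2)

/-- The point `θ_i = 1 - i Δ` of the `i`-th party; `i : Fin p` is the party number `i + 1`. -/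
def node (Δ : ℝ) {p : ℕ} (i : Fin p) : ℝ := 1 - ((i : ℝ) + 1) * Δ

/-- Run the circuit `C` on `j` copies of the input state, measuring each; then output the
frequency of the outcome `Π` among all `ℓ` runs, if it occurred `s` times before. -/
def evalLoop {A : Architecture} (C : A.Circuit) (ℓ : ℕ) : (j : ℕ) → (s : ℕ) → Program A.n
  | 0, s => .output ((s : ℝ) / (ℓ : ℝ))
  | j + 1, s => .newCopy ((List.finRange A.m).foldr (fun k Q => .gate (A.site k) (C k) Q)
      (.measure fun b => evalLoop C ℓ j (if b then s + 1 else s)))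

/-- The scheme `(Gen, Eval, Rec)`: the shares are `C_i = C(1 - i Δ)` (all of them for the same Haar
random gates), a party runs its share on `ℓ` copies of the input state, and the result is
recovered by Lagrange interpolation. -/
def cayleyScheme (A : ℕ → Architecture) (p : ℕ → ℕ) (Δ : ℕ → ℝ) (ℓ : ℕ → ℕ) : Scheme A p where
  Share sec _ := (A sec).Circuit
  gen sec C := (haarCircuit (A sec)).map fun H i => cayleyCircuit C H (node (Δ sec) i)
  eval sec _ C := evalLoop C (ℓ sec) (ℓ sec) 0
  recon sec := ArithExpr.lagrangeAtZero fun i => node (Δ sec) i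

end

end QFSS

/-! Everything rests on comparing the law of one share with the Haar law, at `θ = 1 - ε`, `ε = iΔ`.

Upper bound. The map `H = f(h) ↦ f(θh)` shrinks operator-norm distances by a factor no smaller than
`θ` (`norm_cayley_sub_le`), a consequence of the resolvent identity for `f(A) = 2(1 - iA)⁻¹ - 1`.
Haar measure on the unitary group is, up to a constant, the Hausdorff measure of dimension `d`, the
real dimension of the Hermitian matrices (`exists_hausdorffMeasure_eq_smul_haarUnitary`). Hence
`θ^d` times the law of `f(θh)` is at most Haar measure, and so is `θ^d` times the law of `C_k
f(θh)`, by invariance. For `m` independent gates on at most two qubits, `θ^(32m)` times the law of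
any share is dominated by one law that does not depend on the circuit (`map_cayleyCircuit_le`). The
advantage is therefore at most `1 - θ^(32m) ≤ 32mε`.

Lower bound. Take all gates `1` against all gates `-1` and look at the trace of the first gate.
Shrinking `h` to `θh` moves every eigenvalue `e^{iφ}` towards `1`, raising its real part by at least
`(1 - θ²)/4 · (1 - cos 2φ)`. The Haar means of `tr U` and `tr U²` vanish, so the normalized trace
has mean at least `(1 - θ²)/4` in one case and minus the same mean in the other
(`integral_firstGateTrace`). A guess biased by this trace has advantage at least `ε/8`.

Since `Δ` is at least an inverse polynomial, this advantage is not negligible, which refutes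
security and hence the QFSS property. -/

namespace QFSS

open scoped Matrix.Norms.L2Operator NNReal

/-! ### Resolvent identities and metric distortion of the Cayley transform -/

section CayleyAlgebra

variable {ι : Type*} [Fintype ι] [DecidableEq ι]

/-- The resolvent `(1 - iA)⁻¹`. -/
noncomputable def cayleyResolvent (A : Matrix ι ι ℂ) : Matrix ι ι ℂ :=
  (1 - Complex.I • A)⁻¹

-- `(1 + iA)(1 - iA) = 1 + A*A` is positive definite, so both factors are invertible.
open scoped ComplexOrder in
theorem isUnit_det_one_sub_I_smul {A : Matrix ι ι ℂ} (hA : A.IsHermitian) :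
    IsUnit (1 - Complex.I • A).det := by
  have e : (1 + Complex.I • A) * (1 - Complex.I • A) = 1 + A.conjTranspose * A := by
    simp only [hA.eq, mul_sub, add_mul, one_mul, mul_one, Matrix.smul_mul,
      Matrix.mul_smul, smul_smul, Complex.I_mul_I, neg_smul, one_smul]
    abel
  have hpos : ((1 + Complex.I • A) * (1 - Complex.I • A)).PosDef := by
    rw [e]
    exact Matrix.PosDef.one.add_posSemidef (Matrix.posSemidef_conjTranspose_mul_self A)
  have hdet := (Matrix.isUnit_iff_isUnit_det _).1 hpos.isUnit
  rw [Matrix.det_mul] at hdet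
  exact isUnit_of_mul_isUnit_right hdet

theorem cayleyResolvent_mul {A : Matrix ι ι ℂ} (hA : A.IsHermitian) :
    cayleyResolvent A * (1 - Complex.I • A) = 1 :=
  Matrix.nonsing_inv_mul _ (isUnit_det_one_sub_I_smul hA)

theorem mul_cayleyResolvent {A : Matrix ι ι ℂ} (hA : A.IsHermitian) :
    (1 - Complex.I • A) * cayleyResolvent A = 1 :=
  Matrix.mul_nonsing_inv _ (isUnit_det_one_sub_I_smul hA)

theorem cayley_eq_resolvent {A : Matrix ι ι ℂ} (hA : A.IsHermitian) :
    cayley A = (2 : ℂ) • cayleyResolvent A - 1 := by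
  have : (1 + Complex.I • A) = (2 : ℂ) • (1 : Matrix ι ι ℂ) - (1 - Complex.I • A) := by
    rw [two_smul]; abel
  unfold cayley
  rw [this, sub_mul]
  change _ * cayleyResolvent A - _ * cayleyResolvent A = _
  rw [mul_cayleyResolvent hA, Matrix.smul_mul, one_mul]

theorem cayleyResolvent_sub {A B : Matrix ι ι ℂ} (hA : A.IsHermitian) (hB : B.IsHermitian) :
    cayleyResolvent A - cayleyResolvent B
      = Complex.I • (cayleyResolvent A * (A - B) * cayleyResolvent B) := by
  have : Complex.I • (A - B) = (1 - Complex.I • B) - (1 - Complex.I • A) := by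
    rw [smul_sub]; abel
  rw [← Matrix.smul_mul, ← Matrix.mul_smul, this, mul_sub, sub_mul, cayleyResolvent_mul hA,
    mul_assoc, mul_cayleyResolvent hB, mul_one, one_mul]

/-- This is the resolvent identity, since `f = 2R - 1`; it turns distances between unitaries into
distances between Hermitian matrices. -/
theorem cayley_sub {A B : Matrix ι ι ℂ} (hA : A.IsHermitian) (hB : B.IsHermitian) :
    cayley A - cayley B
      = (2 * Complex.I) • (cayleyResolvent A * (A - B) * cayleyResolvent B) := by
  rw [cayley_eq_resolvent hA, cayley_eq_resolvent hB, sub_sub_sub_cancel_right, ← smul_sub,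
    cayleyResolvent_sub hA hB, smul_smul]

/-- Only an inequality, so that the empty index type, where the identity has norm `0`, is covered.
-/
theorem norm_le_one_of_mem_unitaryGroup {U : Matrix ι ι ℂ} (hU : U ∈ Matrix.unitaryGroup ι ℂ) :
    ‖U‖ ≤ 1 := by
  cases subsingleton_or_nontrivial (Matrix ι ι ℂ)
  · rw [Subsingleton.elim U 0, norm_zero]; exact zero_le_one
  · exact (CStarRing.norm_of_mem_unitary hU).le

theorem norm_one_matrix_le : ‖(1 : Matrix ι ι ℂ)‖ ≤ 1 :=
  norm_le_one_of_mem_unitaryGroup (one_mem _)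

/-- `2R(A) = f(A) + 1` with `f(A)` unitary. -/
theorem norm_cayleyResolvent_le {A : Matrix ι ι ℂ} (hA : A.IsHermitian) :
    ‖cayleyResolvent A‖ ≤ 1 := by
  have h : (2 : ℂ) • cayleyResolvent A = cayley A + 1 := by
    rw [cayley_eq_resolvent hA]; abel
  have h2 : ‖(2 : ℂ) • cayleyResolvent A‖ ≤ 1 + 1 := by
    rw [h]
    exact (norm_add_le _ _).trans (add_le_add
      (norm_le_one_of_mem_unitaryGroup (cayley_mem_unitaryGroup hA)) norm_one_matrix_le)
  rw [norm_smul] at h2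
  norm_num at h2
  linarith

omit [Fintype ι] [DecidableEq ι] in
theorem isHermitian_ofReal_smul {A : Matrix ι ι ℂ} (hA : A.IsHermitian) (θ : ℝ) :
    ((θ : ℂ) • A).IsHermitian := by
  unfold Matrix.IsHermitian at hA ⊢
  rw [Matrix.conjTranspose_smul, hA]
  simp

/-- The product equals `θ + (1 - θ) R(A)`, a convex combination of contractions. -/
theorem norm_cayleyResolvent_mul_le {A : Matrix ι ι ℂ} (hA : A.IsHermitian) {θ : ℝ}
    (h0 : 0 ≤ θ) (h1 : θ ≤ 1) :
    ‖cayleyResolvent A * (1 - Complex.I • ((θ : ℂ) • A))‖ ≤ 1 := by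
  have e : 1 - Complex.I • ((θ : ℂ) • A)
      = (θ : ℂ) • (1 - Complex.I • A) + ((1 - θ : ℝ) : ℂ) • (1 : Matrix ι ι ℂ) := by
    push_cast
    rw [smul_sub, sub_smul, one_smul, smul_comm Complex.I]
    abel
  rw [e, mul_add, Matrix.mul_smul, Matrix.mul_smul, mul_one, cayleyResolvent_mul hA]
  refine (norm_add_le _ _).trans ?_
  rw [norm_smul, norm_smul, Complex.norm_real, Complex.norm_real, Real.norm_of_nonneg h0,
    Real.norm_of_nonneg (sub_nonneg.2 h1)]
  nlinarith [norm_one_matrix_le (ι := ι), norm_cayleyResolvent_le hA]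

theorem norm_mul_cayleyResolvent_le {A : Matrix ι ι ℂ} (hA : A.IsHermitian) {θ : ℝ}
    (h0 : 0 ≤ θ) (h1 : θ ≤ 1) :
    ‖(1 - Complex.I • ((θ : ℂ) • A)) * cayleyResolvent A‖ ≤ 1 := by
  have e : 1 - Complex.I • ((θ : ℂ) • A)
      = (θ : ℂ) • (1 - Complex.I • A) + ((1 - θ : ℝ) : ℂ) • (1 : Matrix ι ι ℂ) := by
    push_cast
    rw [smul_sub, sub_smul, one_smul, smul_comm Complex.I]
    abel
  rw [e, add_mul, Matrix.smul_mul, Matrix.smul_mul, one_mul, mul_cayleyResolvent hA]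
  refine (norm_add_le _ _).trans ?_
  rw [norm_smul, norm_smul, Complex.norm_real, Complex.norm_real, Real.norm_of_nonneg h0,
    Real.norm_of_nonneg (sub_nonneg.2 h1)]
  nlinarith [norm_one_matrix_le (ι := ι), norm_cayleyResolvent_le hA]

/-- The Cayley transforms of `A` and `B` are at most `θ⁻¹` times as far apart as those of `θ A`
and `θ B`. -/
theorem norm_cayley_sub_le {A B : Matrix ι ι ℂ} (hA : A.IsHermitian) (hB : B.IsHermitian) {θ : ℝ}
    (h0 : 0 ≤ θ) (h1 : θ ≤ 1) :
    θ * ‖cayley A - cayley B‖ ≤ ‖cayley ((θ : ℂ) • A) - cayley ((θ : ℂ) • B)‖ := by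
  have hA' := isHermitian_ofReal_smul hA θ
  have hB' := isHermitian_ofReal_smul hB θ
  set D := cayley ((θ : ℂ) • A) - cayley ((θ : ℂ) • B) with hD
  -- Inserting `(1 - iθA) R(θA) = 1` and its mirror image into the resolvent identity for `A`, `B`
  -- exhibits the one for `θA`, `θB` between two contractions.
  have key : (θ : ℂ) • (cayley A - cayley B)
      = (cayleyResolvent A * (1 - Complex.I • ((θ : ℂ) • A))) * D
        * ((1 - Complex.I • ((θ : ℂ) • B)) * cayleyResolvent B) := by
    rw [hD, cayley_sub hA' hB', cayley_sub hA hB, ← smul_sub]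
    calc _ = (2 * Complex.I * θ) • (cayleyResolvent A * (A - B) * cayleyResolvent B) := by
          rw [smul_smul]; congr 1; ring
      _ = (2 * Complex.I * θ) • (cayleyResolvent A *
          ((1 - Complex.I • ((θ : ℂ) • A)) * cayleyResolvent ((θ : ℂ) • A)) * (A - B) *
          (cayleyResolvent ((θ : ℂ) • B) * (1 - Complex.I • ((θ : ℂ) • B)))
          * cayleyResolvent B) := by
          rw [mul_cayleyResolvent hA', cayleyResolvent_mul hB', mul_one, mul_one]
      _ = _ := by
          simp only [Matrix.mul_smul, Matrix.smul_mul, smul_smul, mul_assoc]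
  have hn : ‖(θ : ℂ) • (cayley A - cayley B)‖ = θ * ‖cayley A - cayley B‖ := by
    rw [norm_smul, Complex.norm_real, Real.norm_of_nonneg h0]
  rw [← hn, key]
  refine (norm_mul_le _ _).trans ?_
  refine (mul_le_mul (norm_mul_le _ _) (norm_mul_cayleyResolvent_le hB h0 h1) (norm_nonneg _)
    (by positivity)).trans ?_
  rw [mul_one]
  exact mul_le_of_le_one_left (norm_nonneg _) (norm_cayleyResolvent_mul_le hA h0 h1)

theorem norm_cayley_sub_le_two_mul {A B : Matrix ι ι ℂ} (hA : A.IsHermitian)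
    (hB : B.IsHermitian) : ‖cayley A - cayley B‖ ≤ 2 * ‖A - B‖ := by
  rw [cayley_sub hA hB, norm_smul]
  have h : ‖cayleyResolvent A * (A - B) * cayleyResolvent B‖ ≤ ‖A - B‖ := by
    refine (norm_mul_le _ _).trans ?_
    refine (mul_le_mul (norm_mul_le _ _) (norm_cayleyResolvent_le hB) (norm_nonneg _)
      (by positivity)).trans ?_
    rw [mul_one]
    exact mul_le_of_le_one_left (norm_nonneg _) (norm_cayleyResolvent_le hA)
  simpa using h

theorem norm_one_sub_I_smul_le {A : Matrix ι ι ℂ} (hA : ‖A‖ ≤ 1) : ‖1 - Complex.I • A‖ ≤ 2 := by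
  refine (norm_sub_le _ _).trans ?_
  rw [norm_smul, Complex.norm_I, one_mul]
  linarith [norm_one_matrix_le (ι := ι)]

/-- Solving the resolvent identity for `A - B` leaves the factors `1 - iA` and `1 - iB`, which are
bounded only on bounded sets. On the unit ball this makes the Cayley chart bi-Lipschitz. -/
theorem norm_sub_le_norm_cayley_sub {A B : Matrix ι ι ℂ} (hA : A.IsHermitian)
    (hB : B.IsHermitian) (hA1 : ‖A‖ ≤ 1) (hB1 : ‖B‖ ≤ 1) :
    ‖A - B‖ ≤ 2 * ‖cayley A - cayley B‖ := by
  have key : (2 * Complex.I) • (A - B)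
      = (1 - Complex.I • A) * (cayley A - cayley B) * (1 - Complex.I • B) := by
    rw [cayley_sub hA hB, Matrix.mul_smul, Matrix.smul_mul]
    congr 1
    calc A - B = ((1 - Complex.I • A) * cayleyResolvent A) * (A - B) *
          (cayleyResolvent B * (1 - Complex.I • B)) := by
          rw [mul_cayleyResolvent hA, cayleyResolvent_mul hB, one_mul, mul_one]
      _ = _ := by simp only [mul_assoc]
  have hn : ‖(2 * Complex.I) • (A - B)‖ = 2 * ‖A - B‖ := by
    rw [norm_smul]; simp
  have : 2 * ‖A - B‖ ≤ 2 * ‖cayley A - cayley B‖ * 2 := by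
    rw [← hn, key]
    refine (norm_mul_le _ _).trans (mul_le_mul ((norm_mul_le _ _).trans
      (mul_le_mul_of_nonneg_right (norm_one_sub_I_smul_le hA1) (norm_nonneg _)))
      (norm_one_sub_I_smul_le hB1) (norm_nonneg _) (by positivity))
  linarith

theorem one_add_cayley {A : Matrix ι ι ℂ} (hA : A.IsHermitian) :
    1 + cayley A = (2 : ℂ) • cayleyResolvent A := by
  rw [cayley_eq_resolvent hA]; abel

theorem isUnit_det_one_add_cayley {A : Matrix ι ι ℂ} (hA : A.IsHermitian) :
    IsUnit (1 + cayley A).det := by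
  rw [one_add_cayley hA, Matrix.det_smul]
  refine IsUnit.mul (by simp) ?_
  unfold cayleyResolvent
  rw [Matrix.det_nonsing_inv, isUnit_ringInverse]
  exact isUnit_det_one_sub_I_smul hA

theorem invCayley_cayley {A : Matrix ι ι ℂ} (hA : A.IsHermitian) :
    invCayley (cayley A) = A := by
  have hu := isUnit_det_one_add_cayley hA
  have h1 : 1 - cayley A = -(Complex.I • A * (1 + cayley A)) := by
    have h2 : (1 - Complex.I • A) * (1 + cayley A) = (2 : ℂ) • 1 := by
      rw [one_add_cayley hA, Matrix.mul_smul, mul_cayleyResolvent hA]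
    rw [sub_mul, one_mul, two_smul] at h2
    have h3 : Complex.I • A * (1 + cayley A) = 1 + cayley A - (1 + 1) := by
      rw [← h2]; abel
    rw [h3]; abel
  unfold invCayley
  rw [h1, Matrix.neg_mul, mul_assoc, Matrix.mul_nonsing_inv _ hu, mul_one, smul_neg, smul_smul,
    Complex.I_mul_I]
  simp

theorem cayley_invCayley {U : Matrix ι ι ℂ} (hu : IsUnit (1 + U).det) :
    cayley (invCayley U) = U := by
  have hI : Complex.I • invCayley U = -((1 - U) * (1 + U)⁻¹) := by
    unfold invCayley
    rw [smul_smul, Complex.I_mul_I, neg_smul, one_smul]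
  have h1 : 1 - Complex.I • invCayley U = (2 : ℂ) • (1 + U)⁻¹ := by
    rw [hI, sub_neg_eq_add]
    nth_rw 1 [← Matrix.mul_nonsing_inv _ hu]
    rw [← add_mul, add_add_sub_cancel, one_add_one_eq_two, ← one_add_one_eq_two, add_mul, one_mul,
      two_smul]
  have h2 : 1 + Complex.I • invCayley U = (2 : ℂ) • (U * (1 + U)⁻¹) := by
    rw [hI, ← sub_eq_add_neg]
    nth_rw 1 [← Matrix.mul_nonsing_inv _ hu]
    rw [← sub_mul, add_sub_sub_cancel, add_mul, two_smul]
  have h3 : (1 - Complex.I • invCayley U)⁻¹ = (2⁻¹ : ℂ) • (1 + U) := by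
    apply Matrix.inv_eq_left_inv
    rw [h1, Matrix.smul_mul, Matrix.mul_smul, Matrix.mul_nonsing_inv _ hu, smul_smul]
    simp
  unfold cayley
  rw [h2, h3, Matrix.smul_mul, Matrix.mul_smul, mul_assoc, Matrix.nonsing_inv_mul _ hu, mul_one,
    smul_smul]
  simp

end CayleyAlgebra

/-! ### Haar measure as Hausdorff measure, and its distortion along the Cayley path -/

section HaarHausdorff

variable {ι : Type*} [Fintype ι] [DecidableEq ι]

/-- The unitary matrices without the eigenvalue `-1`. -/
def genericUnitary (ι : Type*) [Fintype ι] [DecidableEq ι] : Set (Matrix.unitaryGroup ι ℂ) :=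
  {H | IsUnit (1 + (H : Matrix ι ι ℂ)).det}

theorem isOpen_genericUnitary : IsOpen (genericUnitary ι) := by
  have : genericUnitary ι = (fun H : Matrix.unitaryGroup ι ℂ =>
      (1 + (H : Matrix ι ι ℂ)).det) ⁻¹' {0}ᶜ := by
    ext H; simp [genericUnitary, isUnit_iff_ne_zero]
  have h : Continuous fun H : Matrix.unitaryGroup ι ℂ => 1 + (H : Matrix ι ι ℂ) :=
    continuous_const.add continuous_subtype_val
  rw [this]
  exact isOpen_compl_singleton.preimage h.matrix_det

theorem continuousOn_invCayley :
    ContinuousOn (fun H : Matrix.unitaryGroup ι ℂ => invCayley (H : Matrix ι ι ℂ))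
      (genericUnitary ι) := by
  unfold invCayley
  have h' : Continuous fun H : Matrix.unitaryGroup ι ℂ => 1 - (H : Matrix ι ι ℂ) :=
    continuous_const.sub continuous_subtype_val
  refine ContinuousOn.const_smul (ContinuousOn.mul h'.continuousOn ?_) Complex.I
  simp only [Matrix.inv_def, Ring.inverse_eq_inv']
  have h : Continuous fun H : Matrix.unitaryGroup ι ℂ => 1 + (H : Matrix ι ι ℂ) :=
    continuous_const.add continuous_subtype_val
  exact (h.matrix_det.continuousOn.inv₀ fun H hH => hH.ne_zero).smul
    h.matrix_adjugate.continuousOn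

theorem continuousOn_cayley :
    ContinuousOn (cayley : Matrix ι ι ℂ → Matrix ι ι ℂ) {A | A.IsHermitian} := by
  unfold cayley
  have h : Continuous fun A : Matrix ι ι ℂ => 1 - Complex.I • A := by fun_prop
  refine ContinuousOn.mul (by fun_prop) ?_
  simp only [Matrix.inv_def, Ring.inverse_eq_inv']
  exact (h.matrix_det.continuousOn.inv₀ fun A hA => (isUnit_det_one_sub_I_smul hA).ne_zero).smul
    h.matrix_adjugate.continuousOn

theorem coe_cayleyPath (θ : ℝ) (H : Matrix.unitaryGroup ι ℂ) :
    (cayleyPath θ H : Matrix ι ι ℂ) = cayley ((θ : ℂ) • invCayley (H : Matrix ι ι ℂ)) := rfl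

theorem continuousOn_cayleyPath (θ : ℝ) :
    ContinuousOn (cayleyPath (ι := ι) θ) (genericUnitary ι) := by
  rw [Topology.IsInducing.subtypeVal.continuousOn_iff]
  exact continuousOn_cayley.comp (continuousOn_invCayley.const_smul (θ : ℂ)) fun H _ =>
    isHermitian_ofReal_smul (invCayley_isHermitian H) θ

theorem cayleyPath_of_notMem (θ : ℝ) {H : Matrix.unitaryGroup ι ℂ} (hH : H ∉ genericUnitary ι) :
    cayleyPath θ H = 1 := by
  have : invCayley (H : Matrix ι ι ℂ) = 0 := by
    unfold invCayley
    rw [Matrix.nonsing_inv_apply_not_isUnit _ hH]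
    simp
  ext1
  rw [coe_cayleyPath, this]
  simp [cayley]

/-- The path is continuous on an open set and constantly `1` off it. -/
theorem measurable_cayleyPath (θ : ℝ) : Measurable (cayleyPath (ι := ι) θ) := by
  classical
  have : cayleyPath (ι := ι) θ = (genericUnitary ι).piecewise (cayleyPath θ) 1 := by
    funext H
    by_cases hH : H ∈ genericUnitary ι
    · simp [hH]
    · simp [hH, cayleyPath_of_notMem θ hH]
  rw [this]
  exact (continuousOn_cayleyPath θ).measurable_piecewise continuousOn_const
    isOpen_genericUnitary.measurableSet

/-- On the generic unitary matrices, the Cayley path to `θ` contracts distances at most by the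
factor `θ`. -/
theorem mul_norm_sub_le_cayleyPath {θ : ℝ} (h0 : 0 ≤ θ) (h1 : θ ≤ 1)
    {G H : Matrix.unitaryGroup ι ℂ} (hG : G ∈ genericUnitary ι) (hH : H ∈ genericUnitary ι) :
    θ * ‖(G : Matrix ι ι ℂ) - H‖ ≤ ‖(cayleyPath θ G : Matrix ι ι ℂ) - cayleyPath θ H‖ := by
  have h := norm_cayley_sub_le (invCayley_isHermitian G) (invCayley_isHermitian H) h0 h1
  rwa [cayley_invCayley hG, cayley_invCayley hH] at h

/-- The metric given by the operator norm. -/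
noncomputable local instance : MetricSpace (Matrix.unitaryGroup ι ℂ) :=
  inferInstanceAs (MetricSpace {U : Matrix ι ι ℂ // U ∈ Matrix.unitaryGroup ι ℂ})

theorem isometry_mul_left_unitary (V : Matrix.unitaryGroup ι ℂ) : Isometry (V * ·) := by
  refine Isometry.of_dist_eq fun G H => ?_
  rw [Subtype.dist_eq, Subtype.dist_eq, dist_eq_norm, dist_eq_norm]
  change ‖(V : Matrix ι ι ℂ) * G - V * H‖ = _
  rw [← mul_sub]
  exact CStarRing.norm_coe_unitary_mul V _

/-- The real normed space structure of complex matrices. -/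
noncomputable local instance : NormedSpace ℝ (Matrix ι ι ℂ) where
  norm_smul_le r A := by
    have : r • A = (r : ℂ) • A := by ext i j; simp
    rw [this, norm_smul, Complex.norm_real]

/-- The real dimension of the space of Hermitian matrices. -/
noncomputable def hermitianDim (ι : Type*) [Fintype ι] [DecidableEq ι] : ℕ :=
  Module.finrank ℝ (selfAdjoint.submodule ℝ (Matrix ι ι ℂ))

/-- A crude bound by the real dimension of all complex matrices; it affects only the absolute
constant. -/
theorem hermitianDim_le : hermitianDim ι ≤ 2 * Fintype.card ι ^ 2 := by
  refine (Submodule.finrank_le _).trans ?_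
  rw [Module.finrank_matrix]
  simp [Complex.finrank_real_complex]
  nlinarith

/-- The Cayley transform of Hermitian matrices. -/
noncomputable def hermitianCayley (A : selfAdjoint.submodule ℝ (Matrix ι ι ℂ)) :
    Matrix.unitaryGroup ι ℂ :=
  ⟨cayley A, cayley_mem_unitaryGroup A.2⟩

theorem lipschitzWith_hermitianCayley : LipschitzWith 2 (hermitianCayley (ι := ι)) := by
  refine LipschitzWith.of_dist_le_mul fun A B => ?_
  rw [Subtype.dist_eq, Subtype.dist_eq, dist_eq_norm, dist_eq_norm]
  exact norm_cayley_sub_le_two_mul A.2 B.2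

/-- The inverse Cayley transform of unitary matrices. -/
noncomputable def hermitianInvCayley (H : Matrix.unitaryGroup ι ℂ) :
    selfAdjoint.submodule ℝ (Matrix ι ι ℂ) :=
  ⟨invCayley H, invCayley_isHermitian H⟩

theorem hermitianInvCayley_hermitianCayley (A : selfAdjoint.submodule ℝ (Matrix ι ι ℂ)) :
    hermitianInvCayley (hermitianCayley A) = A :=
  Subtype.ext (invCayley_cayley A.2)

theorem hermitianCayley_hermitianInvCayley {H : Matrix.unitaryGroup ι ℂ}
    (hH : H ∈ genericUnitary ι) : hermitianCayley (hermitianInvCayley H) = H :=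
  Subtype.ext (cayley_invCayley hH)

theorem one_mem_genericUnitary : (1 : Matrix.unitaryGroup ι ℂ) ∈ genericUnitary ι := by
  have : (1 : Matrix ι ι ℂ) + 1 = (2 : ℂ) • 1 := by rw [two_smul]
  change IsUnit ((1 : Matrix ι ι ℂ) + 1).det
  rw [this, Matrix.det_smul]
  simp

/-- The Cayley image of the unit ball. -/
def cayleyBall (ι : Type*) [Fintype ι] [DecidableEq ι] : Set (Matrix.unitaryGroup ι ℂ) :=
  hermitianCayley '' Metric.closedBall 0 1

theorem isCompact_cayleyBall : IsCompact (cayleyBall ι) :=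
  (isCompact_closedBall _ _).image lipschitzWith_hermitianCayley.continuous

/-- The identity is interior: the inverse transform is continuous there with value `0`, so all
nearby unitaries come from Hermitian matrices of norm at most `1`. -/
theorem nonempty_interior_cayleyBall : (interior (cayleyBall ι)).Nonempty := by
  refine ⟨1, mem_interior_iff_mem_nhds.2 ?_⟩
  have hE : genericUnitary ι ∈ nhds (1 : Matrix.unitaryGroup ι ℂ) :=
    isOpen_genericUnitary.mem_nhds one_mem_genericUnitary
  have hc : ContinuousAt (fun H : Matrix.unitaryGroup ι ℂ => invCayley (H : Matrix ι ι ℂ)) 1 :=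
    continuousOn_invCayley.continuousAt hE
  have h0 : invCayley ((1 : Matrix.unitaryGroup ι ℂ) : Matrix ι ι ℂ) = 0 := by
    simp [invCayley]
  have hb : Metric.closedBall (0 : Matrix ι ι ℂ) 1
      ∈ nhds (invCayley ((1 : Matrix.unitaryGroup ι ℂ) : Matrix ι ι ℂ)) := by
    rw [h0]; exact Metric.closedBall_mem_nhds _ one_pos
  filter_upwards [hE, hc.preimage_mem_nhds hb] with H hH hH1
  exact ⟨hermitianInvCayley H, mem_closedBall_zero_iff.2 (mem_closedBall_zero_iff.1 hH1),
    hermitianCayley_hermitianInvCayley hH⟩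

theorem lipschitzOnWith_hermitianInvCayley :
    LipschitzOnWith 2 (hermitianInvCayley (ι := ι)) (cayleyBall ι) := by
  refine LipschitzOnWith.of_dist_le_mul ?_
  rintro _ ⟨A, hA, rfl⟩ _ ⟨B, hB, rfl⟩
  rw [hermitianInvCayley_hermitianCayley, hermitianInvCayley_hermitianCayley, Subtype.dist_eq,
    Subtype.dist_eq, dist_eq_norm, dist_eq_norm]
  exact norm_sub_le_norm_cayley_sub A.2 B.2 (by simpa using hA) (by simpa using hB)

noncomputable local instance : MeasurableSpace (selfAdjoint.submodule ℝ (Matrix ι ι ℂ)) := borel _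

local instance : BorelSpace (selfAdjoint.submodule ℝ (Matrix ι ι ℂ)) := ⟨rfl⟩

local instance :
    (μH[(hermitianDim ι : ℝ)] :
      Measure (selfAdjoint.submodule ℝ (Matrix ι ι ℂ))).IsAddHaarMeasure :=
  isAddHaarMeasure_hausdorffMeasure

/-- In the space of Hermitian matrices, the Hausdorff measure of full dimension is an additive Haar
measure; the two Lipschitz bounds of the chart carry finiteness, here, and positivity, below, over
to the group. -/
theorem hausdorffMeasure_cayleyBall_ne_top :
    μH[(hermitianDim ι : ℝ)] (cayleyBall ι) ≠ ∞ := by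
  have h := lipschitzWith_hermitianCayley.hausdorffMeasure_image_le (d := hermitianDim ι)
    (by positivity) (Metric.closedBall (0 : selfAdjoint.submodule ℝ (Matrix ι ι ℂ)) 1)
  refine ne_top_of_le_ne_top (ENNReal.mul_ne_top ?_ ?_) h
  · simp
  · exact (isCompact_closedBall _ _).measure_lt_top.ne

theorem hausdorffMeasure_cayleyBall_ne_zero :
    μH[(hermitianDim ι : ℝ)] (cayleyBall ι) ≠ 0 := by
  have h := (lipschitzOnWith_hermitianInvCayley (ι := ι)).hausdorffMeasure_image_le
    (d := hermitianDim ι) (by positivity)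
  have e : hermitianInvCayley '' cayleyBall ι = Metric.closedBall 0 1 := by
    unfold cayleyBall
    rw [Set.image_image]
    simp [hermitianInvCayley_hermitianCayley]
  intro h0
  rw [e, h0, mul_zero] at h
  have : 0 < μH[(hermitianDim ι : ℝ)]
      (Metric.closedBall (0 : selfAdjoint.submodule ℝ (Matrix ι ι ℂ)) 1) :=
    Metric.measure_closedBall_pos _ _ one_pos
  exact this.not_ge h

/-- Hausdorff measure is a multiple of Haar measure. -/
theorem exists_hausdorffMeasure_eq_smul_haarUnitary :
    ∃ c : ℝ≥0∞, c ≠ 0 ∧ c ≠ ∞ ∧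
      (μH[(hermitianDim ι : ℝ)] : Measure (Matrix.unitaryGroup ι ℂ)) = c • haarUnitary ι := by
  set μ : Measure (Matrix.unitaryGroup ι ℂ) := μH[(hermitianDim ι : ℝ)] with hμ
  -- Left multiplication by a unitary is an isometry for the operator norm.
  have hinv : μ.IsMulLeftInvariant := by
    refine ⟨fun V => ?_⟩
    have h := (isometry_mul_left_unitary V).map_hausdorffMeasure (d := hermitianDim ι)
      (Or.inl (by positivity))
    rw [h, (mul_left_surjective V).range_eq, Measure.restrict_univ]
  -- One compact set with nonempty interior and positive finite measure suffices for an invariant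
  -- measure to be Haar.
  have hh : μ.IsHaarMeasure := Measure.isHaarMeasure_of_isCompact_nonempty_interior μ
    (cayleyBall ι) isCompact_cayleyBall nonempty_interior_cayleyBall
    hausdorffMeasure_cayleyBall_ne_zero hausdorffMeasure_cayleyBall_ne_top
  refine ⟨μ Set.univ, ?_, ?_, ?_⟩
  · exact (isOpen_univ.measure_pos μ Set.univ_nonempty).ne'
  · exact isCompact_univ.measure_lt_top.ne
  · exact Measure.haarMeasure_unique μ ⊤

instance : (haarUnitary ι).IsHaarMeasure := Measure.isHaarMeasure_haarMeasure _

instance : IsProbabilityMeasure (haarUnitary ι) :=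
  ⟨Measure.haarMeasure_self⟩

/-- The path is antilipschitz with constant `θ⁻¹` on generic unitaries, so preimages grow by at most
`θ⁻¹` to the power of the dimension in Hausdorff measure. The constant relating it to Haar measure
cancels. -/
theorem haarUnitary_preimage_cayleyPath_inter_le {θ : ℝ} (h0 : 0 < θ) (h1 : θ ≤ 1)
    (s : Set (Matrix.unitaryGroup ι ℂ)) :
    ENNReal.ofReal θ ^ hermitianDim ι * haarUnitary ι (cayleyPath θ ⁻¹' s ∩ genericUnitary ι)
      ≤ haarUnitary ι s := by
  obtain ⟨c, hc0, hc1, hc⟩ := exists_hausdorffMeasure_eq_smul_haarUnitary (ι := ι)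
  have hanti : AntilipschitzWith (Real.toNNReal θ)⁻¹
      (fun H : genericUnitary ι => cayleyPath θ (H : Matrix.unitaryGroup ι ℂ)) := by
    refine AntilipschitzWith.of_le_mul_dist fun G H => ?_
    have h := mul_norm_sub_le_cayleyPath h0.le h1 G.2 H.2
    rw [Subtype.dist_eq, Subtype.dist_eq, Subtype.dist_eq, dist_eq_norm, dist_eq_norm]
    rw [NNReal.coe_inv, Real.coe_toNNReal _ h0.le, inv_mul_eq_div, le_div_iff₀ h0, mul_comm]
    exact h
  have h := hanti.hausdorffMeasure_preimage_le (d := hermitianDim ι) (by positivity) s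
  rw [← isometry_subtype_coe.hausdorffMeasure_image (Or.inl (by positivity))] at h
  have e : (Subtype.val '' ((fun H : genericUnitary ι =>
      cayleyPath θ (H : Matrix.unitaryGroup ι ℂ)) ⁻¹' s))
      = cayleyPath θ ⁻¹' s ∩ genericUnitary ι := by
    ext H; simp [and_comm]
  rw [e, hc, Measure.smul_apply, Measure.smul_apply, smul_eq_mul, smul_eq_mul] at h
  rw [ENNReal.rpow_natCast, mul_left_comm, ENNReal.mul_le_mul_iff_right hc0 hc1] at h
  rw [ENNReal.coe_inv (by simpa using h0), ← ENNReal.ofReal, ← ENNReal.inv_pow] at h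
  exact (ENNReal.mul_le_iff_le_inv (pow_ne_zero _ (by simpa using h0))
    (ENNReal.pow_ne_top ENNReal.ofReal_ne_top)).2 h

end HaarHausdorff

/-! ### Scalar phases: the null set of eigenvalue `-1`, domination by Haar measure, vanishing
moments -/

section Phases

variable {ι : Type*} [Fintype ι] [DecidableEq ι]

/-- The scalar unitary matrix with phase `z`. -/
def phaseUnitary (z : Circle) : Matrix.unitaryGroup ι ℂ :=
  ⟨(z : ℂ) • 1, by
    rw [Matrix.mem_unitaryGroup_iff, star_smul, star_one, Matrix.smul_mul, Matrix.mul_smul,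
      smul_smul, one_mul]
    simp [Complex.mul_conj, Circle.normSq_coe]⟩

theorem coe_phaseUnitary_mul (z : Circle) (U : Matrix.unitaryGroup ι ℂ) :
    ((phaseUnitary z * U : Matrix.unitaryGroup ι ℂ) : Matrix ι ι ℂ)
      = (z : ℂ) • (U : Matrix ι ι ℂ) := by
  change ((z : ℂ) • (1 : Matrix ι ι ℂ)) * U = _
  rw [Matrix.smul_mul, one_mul]

/-- `zU` has the eigenvalue `-1` exactly when `-z⁻¹` is an eigenvalue of `U`; distinct phases use up
distinct roots of the characteristic polynomial. -/
theorem card_phases_not_generic_le (U : Matrix.unitaryGroup ι ℂ) (z : ℕ ↪ Circle)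
    (s : Finset ℕ) [DecidablePred fun k => phaseUnitary (z k) * U ∉ genericUnitary ι] :
    (s.filter fun k => phaseUnitary (z k) * U ∉ genericUnitary ι).card ≤ Fintype.card ι := by
  classical
  have hroots : (U : Matrix ι ι ℂ).charpoly.roots.toFinset.card ≤ Fintype.card ι := by
    refine (Multiset.toFinset_card_le _).trans ((Polynomial.card_roots' _).trans ?_)
    rw [Matrix.charpoly_natDegree_eq_dim]
  refine le_trans (Finset.card_le_card_of_injOn (fun k => -((z k : ℂ)⁻¹)) ?_ ?_) hroots
  · intro k hk
    have hk : phaseUnitary (z k) * U ∉ genericUnitary ι := (Finset.mem_filter.1 hk).2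
    have hz : (z k : ℂ) ≠ 0 := Circle.coe_ne_zero _
    simp only [genericUnitary, Set.mem_ofPred_eq, coe_phaseUnitary_mul, isUnit_iff_ne_zero,
      not_not] at hk
    rw [Finset.mem_coe, Multiset.mem_toFinset,
      Polynomial.mem_roots (Matrix.charpoly_monic _).ne_zero, Polynomial.IsRoot,
      Matrix.eval_charpoly]
    have e : Matrix.scalar ι (-((z k : ℂ)⁻¹)) - (U : Matrix ι ι ℂ)
        = (-((z k : ℂ)⁻¹)) • (1 + (z k : ℂ) • (U : Matrix ι ι ℂ)) := by
      rw [smul_add, smul_smul, neg_mul, inv_mul_cancel₀ hz, neg_smul, neg_smul, one_smul,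
        ← sub_eq_add_neg, Matrix.scalar_apply, ← Matrix.smul_one_eq_diagonal, neg_smul]
    rw [e, Matrix.det_smul, hk, mul_zero]
  · intro k _ l _ hkl
    exact z.injective (Circle.coe_injective (inv_injective (neg_injective hkl)))

/-- By invariance, all translates of the set by phases have the same measure, while each point lies
in boundedly many of them. Infinitely many phases force measure `0`. -/
theorem haarUnitary_compl_genericUnitary : haarUnitary ι (genericUnitary ι)ᶜ = 0 := by
  classical
  have : Infinite Circle := by
    refine Infinite.of_injective (fun n : ℕ => Circle.exp (1 / ((n : ℝ) + 1))) fun m n h => ?_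
    have harg : ∀ k : ℕ, Complex.arg (Circle.exp (1 / ((k : ℝ) + 1))) = 1 / ((k : ℝ) + 1) := by
      intro k
      have h1 : 1 / ((k : ℝ) + 1) ≤ 1 := by
        rw [div_le_one (by positivity)]; linarith [Nat.cast_nonneg (α := ℝ) k]
      have h0 : 0 < 1 / ((k : ℝ) + 1) := by positivity
      exact Circle.arg_exp (by linarith [Real.pi_gt_three]) (by linarith [Real.pi_gt_three])
    have h2 := congrArg (fun w : Circle => Complex.arg w) h
    simp only [harg] at h2
    simpa using h2
  set z : ℕ ↪ Circle := Infinite.natEmbedding Circle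
  set p := haarUnitary ι (genericUnitary ι)ᶜ with hp
  have hm : MeasurableSet (genericUnitary ι)ᶜ := isOpen_genericUnitary.measurableSet.compl
  have hmk : ∀ k, Measurable fun U : Matrix.unitaryGroup ι ℂ =>
      (genericUnitary ι)ᶜ.indicator (1 : Matrix.unitaryGroup ι ℂ → ℝ≥0∞) (phaseUnitary (z k) * U) :=
    fun k => (measurable_one.indicator hm).comp (measurable_const_mul _)
  have hN : ∀ N : ℕ, (N : ℝ≥0∞) * p ≤ Fintype.card ι := by
    intro N
    calc (N : ℝ≥0∞) * p = ∑ k ∈ Finset.range N, ∫⁻ U, (genericUnitary ι)ᶜ.indicator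
          (1 : Matrix.unitaryGroup ι ℂ → ℝ≥0∞) (phaseUnitary (z k) * U) ∂haarUnitary ι := by
          simp_rw [lintegral_mul_left_eq_self (μ := haarUnitary ι)]
          rw [lintegral_indicator_one hm]
          simp [hp]
      _ = ∫⁻ U, ∑ k ∈ Finset.range N, (genericUnitary ι)ᶜ.indicator
          (1 : Matrix.unitaryGroup ι ℂ → ℝ≥0∞) (phaseUnitary (z k) * U) ∂haarUnitary ι := by
          rw [lintegral_finsetSum _ fun k _ => hmk k]
      _ ≤ ∫⁻ _, (Fintype.card ι : ℝ≥0∞) ∂haarUnitary ι := by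
          refine lintegral_mono fun U => ?_
          simp only [Set.indicator_apply, Set.mem_compl_iff, Pi.one_apply]
          rw [Finset.sum_boole]
          exact_mod_cast card_phases_not_generic_le U z _
      _ = Fintype.card ι := by simp
  by_contra h0
  have hp1 : p ≠ ∞ := measure_ne_top _ _
  obtain ⟨N, hN'⟩ := ENNReal.exists_nat_mul_gt h0 (ENNReal.natCast_ne_top (Fintype.card ι))
  exact (hN N).not_gt hN'

/-- The law of the Cayley path at `θ` is dominated by a multiple of Haar measure. -/
theorem map_cayleyPath_le {θ : ℝ} (h0 : 0 < θ) (h1 : θ ≤ 1) (V : Matrix.unitaryGroup ι ℂ) :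
    ENNReal.ofReal θ ^ (2 * Fintype.card ι ^ 2) •
      (haarUnitary ι).map (fun H => V * cayleyPath θ H) ≤ haarUnitary ι := by
  refine Measure.le_iff.2 fun s hs => ?_
  rw [Measure.smul_apply, smul_eq_mul,
    Measure.map_apply ((measurable_cayleyPath θ).const_mul V) hs]
  set t := (V * ·) ⁻¹' s with ht
  have e : haarUnitary ι ((fun H => V * cayleyPath θ H) ⁻¹' s)
      = haarUnitary ι (cayleyPath θ ⁻¹' t ∩ genericUnitary ι) :=
    (measure_inter_conull haarUnitary_compl_genericUnitary).symm
  rw [e, ← measure_preimage_mul (haarUnitary ι) V s]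
  refine le_trans ?_ (haarUnitary_preimage_cayleyPath_inter_le h0 h1 t)
  gcongr ?_ * _
  -- Since `θ ≤ 1`, enlarging the exponent beyond the dimension only weakens the bound.
  exact pow_le_pow_right_of_le_one' (ENNReal.ofReal_le_one.2 h1) hermitianDim_le

theorem continuous_re_trace :
    Continuous fun U : Matrix.unitaryGroup ι ℂ => (U : Matrix ι ι ℂ).trace.re :=
  Complex.continuous_re.comp (Continuous.matrix_trace continuous_subtype_val)

theorem continuous_re_trace_sq :
    Continuous fun U : Matrix.unitaryGroup ι ℂ => ((U : Matrix ι ι ℂ) * U).trace.re :=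
  Complex.continuous_re.comp (Continuous.matrix_trace
    (continuous_subtype_val.mul continuous_subtype_val))

/-- Translation by the phase `-1` changes the sign; for the trace of the square below, the phase `i`
does. -/
theorem integral_re_trace_haarUnitary :
    ∫ U, (U : Matrix ι ι ℂ).trace.re ∂haarUnitary ι = 0 := by
  have h := integral_mul_left_eq_self (μ := haarUnitary ι)
    (fun U : Matrix.unitaryGroup ι ℂ => (U : Matrix ι ι ℂ).trace.re)
    (phaseUnitary (Circle.exp Real.pi))
  simp only [coe_phaseUnitary_mul, Circle.coe_exp, Complex.exp_pi_mul_I, neg_smul, one_smul,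
    Matrix.trace_neg, Complex.neg_re, integral_neg] at h
  linarith

theorem integral_re_trace_sq_haarUnitary :
    ∫ U, ((U : Matrix ι ι ℂ) * U).trace.re ∂haarUnitary ι = 0 := by
  have h := integral_mul_left_eq_self (μ := haarUnitary ι)
    (fun U : Matrix.unitaryGroup ι ℂ => ((U : Matrix ι ι ℂ) * U).trace.re)
    (phaseUnitary (Circle.exp (Real.pi / 2)))
  have hI : Complex.exp ((Real.pi / 2 : ℝ) * Complex.I) = Complex.I := by
    push_cast; exact Complex.exp_pi_div_two_mul_I
  simp only [coe_phaseUnitary_mul, Circle.coe_exp, hI, Matrix.smul_mul, Matrix.mul_smul, smul_smul,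
    Complex.I_mul_I, neg_smul, one_smul, Matrix.trace_neg, Complex.neg_re, integral_neg] at h
  linarith

end Phases

/-! ### The mean trace along the Cayley path -/

section TraceBound

variable {ι : Type*} [Fintype ι] [DecidableEq ι]

/-- With `f(x) = e^{iφ}`, passing to `θx` raises the real part by `2(1 - θ²)x² / ((1 + x²)(1 +
θ²x²))`. Replacing the last factor by `1 + x²` gives exactly `(1 - θ²)/4 · (1 - cos 2φ)`, whose Haar
average is computable from `tr U²`. -/
theorem re_scalar_cayley_ge {x θ : ℝ} (h0 : 0 ≤ θ) (h1 : θ ≤ 1) :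
    ((1 + Complex.I * x) * (1 - Complex.I * x)⁻¹).re
      + (1 - θ ^ 2) / 4 * (1 - (((1 + Complex.I * x) * (1 - Complex.I * x)⁻¹)
        * ((1 + Complex.I * x) * (1 - Complex.I * x)⁻¹)).re)
      ≤ ((1 + Complex.I * ((θ * x : ℝ) : ℂ)) * (1 - Complex.I * ((θ * x : ℝ) : ℂ))⁻¹).re := by
  have key : ∀ y : ℝ, (1 + Complex.I * y) * (1 - Complex.I * y)⁻¹
      = ⟨(1 - y ^ 2) / (1 + y ^ 2), 2 * y / (1 + y ^ 2)⟩ := by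
    intro y
    have hy : (1 : ℝ) + y ^ 2 ≠ 0 := by positivity
    have hy2 : (1 : ℂ) - Complex.I * y ≠ 0 := by
      intro h
      have := congrArg Complex.re h
      simp at this
    rw [mul_inv_eq_iff_eq_mul₀ hy2]
    apply Complex.ext
    · simp; field_simp; ring
    · simp; field_simp; ring
  rw [key, key]
  simp only [Complex.mul_re]
  have hx : (0 : ℝ) < 1 + x ^ 2 := by positivity
  have hθx : (0 : ℝ) < 1 + (θ * x) ^ 2 := by positivity
  have hle : (1 : ℝ) + (θ * x) ^ 2 ≤ 1 + x ^ 2 := by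
    have : θ ^ 2 ≤ 1 := by nlinarith
    nlinarith [sq_nonneg x, mul_le_mul_of_nonneg_right this (sq_nonneg x)]
  have e1 : (1 - x ^ 2) / (1 + x ^ 2) + (1 - θ ^ 2) / 4 *
      (1 - ((1 - x ^ 2) / (1 + x ^ 2) * ((1 - x ^ 2) / (1 + x ^ 2))
        - 2 * x / (1 + x ^ 2) * (2 * x / (1 + x ^ 2))))
      = (1 - x ^ 2) / (1 + x ^ 2) + 2 * (1 - θ ^ 2) * x ^ 2 / (1 + x ^ 2) ^ 2 := by
    field_simp; ring
  have e2 : (1 - (θ * x) ^ 2) / (1 + (θ * x) ^ 2)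
      = (1 - x ^ 2) / (1 + x ^ 2)
        + 2 * (1 - θ ^ 2) * x ^ 2 / ((1 + x ^ 2) * (1 + (θ * x) ^ 2)) := by
    field_simp; ring
  rw [e1, e2]
  have hnum : 0 ≤ 2 * (1 - θ ^ 2) * x ^ 2 := by
    have : θ ^ 2 ≤ 1 := by nlinarith
    have := sub_nonneg.2 this
    positivity
  gcongr
  rw [sq (1 + x ^ 2)]
  exact mul_le_mul_of_nonneg_left hle hx.le

theorem diagonal_conj_mul (V : Matrix.unitaryGroup ι ℂ) (a b : ι → ℂ) :
    ((V : Matrix ι ι ℂ) * Matrix.diagonal a * star (V : Matrix ι ι ℂ)) *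
      ((V : Matrix ι ι ℂ) * Matrix.diagonal b * star (V : Matrix ι ι ℂ))
      = (V : Matrix ι ι ℂ) * Matrix.diagonal (fun j => a j * b j) * star (V : Matrix ι ι ℂ) := by
  have hV : star (V : Matrix ι ι ℂ) * (V : Matrix ι ι ℂ) = 1 := Matrix.mem_unitaryGroup_iff'.1 V.2
  rw [← Matrix.diagonal_mul_diagonal]
  calc _ = (V : Matrix ι ι ℂ) * Matrix.diagonal a * (star (V : Matrix ι ι ℂ) * V)
        * Matrix.diagonal b * star (V : Matrix ι ι ℂ) := by simp only [mul_assoc]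
    _ = _ := by rw [hV, mul_one]; simp only [mul_assoc]

theorem cayley_smul_conj (V : Matrix.unitaryGroup ι ℂ) (x : ι → ℝ) (θ : ℝ) :
    cayley ((θ : ℂ) • ((V : Matrix ι ι ℂ) * Matrix.diagonal (fun j => (x j : ℂ))
      * star (V : Matrix ι ι ℂ)))
      = (V : Matrix ι ι ℂ) * Matrix.diagonal (fun j => (1 + Complex.I * ((θ * x j : ℝ) : ℂ)) *
        (1 - Complex.I * ((θ * x j : ℝ) : ℂ))⁻¹) * star (V : Matrix ι ι ℂ) := by
  have hV : (V : Matrix ι ι ℂ) * star (V : Matrix ι ι ℂ) = 1 := Matrix.mem_unitaryGroup_iff.1 V.2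
  have hlin : ∀ c : ℂ, 1 + c • ((θ : ℂ) • ((V : Matrix ι ι ℂ) * Matrix.diagonal
      (fun j => (x j : ℂ)) * star (V : Matrix ι ι ℂ)))
      = (V : Matrix ι ι ℂ) * Matrix.diagonal (fun j => 1 + c * ((θ * x j : ℝ) : ℂ))
        * star (V : Matrix ι ι ℂ) := by
    intro c
    have : Matrix.diagonal (fun j => 1 + c * ((θ * x j : ℝ) : ℂ))
        = 1 + c • ((θ : ℂ) • Matrix.diagonal (fun j => (x j : ℂ))) := by
      ext i j
      by_cases h : i = j
      · subst h; simp
      · simp [h]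
    rw [this, mul_add, add_mul, mul_one, hV]
    simp only [Matrix.mul_smul, Matrix.smul_mul]
  have hinv : (1 - Complex.I • ((θ : ℂ) • ((V : Matrix ι ι ℂ) * Matrix.diagonal
      (fun j => (x j : ℂ)) * star (V : Matrix ι ι ℂ))))⁻¹
      = (V : Matrix ι ι ℂ) * Matrix.diagonal (fun j => (1 - Complex.I * ((θ * x j : ℝ) : ℂ))⁻¹)
        * star (V : Matrix ι ι ℂ) := by
    apply Matrix.inv_eq_left_inv
    rw [sub_eq_add_neg, ← neg_smul, hlin, diagonal_conj_mul]
    have : (fun j => (1 - Complex.I * ((θ * x j : ℝ) : ℂ))⁻¹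
        * (1 + -Complex.I * ((θ * x j : ℝ) : ℂ))) = fun _ => 1 := by
      funext j
      rw [neg_mul, ← sub_eq_add_neg]
      refine inv_mul_cancel₀ fun h => ?_
      have := congrArg Complex.re h
      simp at this
    rw [this, Matrix.diagonal_one, mul_one, hV]
  unfold cayley
  rw [hinv, hlin, diagonal_conj_mul]

/-- Diagonalizing `h` diagonalizes `H`, `H²` and `f(θh)` together, so the scalar inequality can be
summed over eigenvalues. -/
theorem re_trace_cayleyPath_ge {θ : ℝ} (h0 : 0 ≤ θ) (h1 : θ ≤ 1) {H : Matrix.unitaryGroup ι ℂ}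
    (hH : H ∈ genericUnitary ι) :
    (H : Matrix ι ι ℂ).trace.re
      + (1 - θ ^ 2) / 4 * (Fintype.card ι - ((H : Matrix ι ι ℂ) * H).trace.re)
      ≤ (cayleyPath θ H : Matrix ι ι ℂ).trace.re := by
  have hA := invCayley_isHermitian H
  set V := hA.eigenvectorUnitary with hV
  set x := hA.eigenvalues with hx
  have hs : invCayley (H : Matrix ι ι ℂ)
      = (V : Matrix ι ι ℂ) * Matrix.diagonal (fun j => (x j : ℂ)) * star (V : Matrix ι ι ℂ) := by
    have := hA.spectral_theorem
    rw [Unitary.conjStarAlgAut_apply] at this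
    exact this
  have hV' : star (V : Matrix ι ι ℂ) * (V : Matrix ι ι ℂ) = 1 := Matrix.mem_unitaryGroup_iff'.1 V.2
  have htr : ∀ a : ι → ℂ, ((V : Matrix ι ι ℂ) * Matrix.diagonal a * star (V : Matrix ι ι ℂ)).trace
      = ∑ j, a j := by
    intro a
    rw [Matrix.trace_mul_comm, ← mul_assoc, hV', one_mul, Matrix.trace_diagonal]
  have e1 := cayley_smul_conj V x 1
  rw [← hs, Complex.ofReal_one, one_smul, cayley_invCayley hH] at e1
  have e2 := cayley_smul_conj V x θ
  rw [← hs] at e2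
  have e3 : ((H : Matrix ι ι ℂ) * H).trace = ∑ j, ((1 + Complex.I * x j) * (1 - Complex.I * x j)⁻¹)
        * ((1 + Complex.I * x j) * (1 - Complex.I * x j)⁻¹) := by
    rw [← htr, e1, diagonal_conj_mul]
    simp only [one_mul]
  rw [coe_cayleyPath, e2, e3, e1, htr, htr, Complex.re_sum, Complex.re_sum, Complex.re_sum]
  simp only [one_mul]
  have ec : (Fintype.card ι : ℝ) = ∑ _j : ι, (1 : ℝ) := by simp
  rw [ec, ← Finset.sum_sub_distrib, Finset.mul_sum, ← Finset.sum_add_distrib]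
  exact Finset.sum_le_sum fun j _ => re_scalar_cayley_ge h0 h1

theorem abs_re_trace_le (U : Matrix.unitaryGroup ι ℂ) :
    |(U : Matrix ι ι ℂ).trace.re| ≤ Fintype.card ι := by
  refine (Complex.abs_re_le_norm _).trans ((norm_sum_le _ _).trans ?_)
  refine (Finset.sum_le_sum fun j _ => entry_norm_bound_of_unitary U.2 j j).trans ?_
  simp

theorem integrable_re_trace_cayleyPath (θ : ℝ) :
    Integrable (fun H => (cayleyPath θ H : Matrix ι ι ℂ).trace.re) (haarUnitary ι) := by
  refine Integrable.of_bound (C := Fintype.card ι)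
    (continuous_re_trace.measurable.comp (measurable_cayleyPath θ)).aestronglyMeasurable
    (Eventually.of_forall fun H => ?_)
  exact abs_re_trace_le _

theorem integral_re_trace_cayleyPath_ge {θ : ℝ} (h0 : 0 ≤ θ) (h1 : θ ≤ 1) :
    (1 - θ ^ 2) / 4 * Fintype.card ι
      ≤ ∫ H, (cayleyPath θ H : Matrix ι ι ℂ).trace.re ∂haarUnitary ι := by
  have hi1 : Integrable (fun U : Matrix.unitaryGroup ι ℂ => (U : Matrix ι ι ℂ).trace.re)
      (haarUnitary ι) := by
    refine Integrable.of_bound (C := Fintype.card ι)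
      continuous_re_trace.measurable.aestronglyMeasurable (Eventually.of_forall abs_re_trace_le)
  have hi2 : Integrable (fun U : Matrix.unitaryGroup ι ℂ => ((U : Matrix ι ι ℂ) * U).trace.re)
      (haarUnitary ι) := by
    refine Integrable.of_bound (C := Fintype.card ι)
      continuous_re_trace_sq.measurable.aestronglyMeasurable
      (Eventually.of_forall fun U => abs_re_trace_le (U * U))
  have hi3 : Integrable (fun U : Matrix.unitaryGroup ι ℂ => (1 - θ ^ 2) / 4 *
      ((Fintype.card ι : ℝ) - ((U : Matrix ι ι ℂ) * U).trace.re)) (haarUnitary ι) :=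
    ((integrable_const _).sub hi2).const_mul _
  calc (1 - θ ^ 2) / 4 * Fintype.card ι = ∫ U, ((U : Matrix ι ι ℂ).trace.re
      + (1 - θ ^ 2) / 4 * (Fintype.card ι - ((U : Matrix ι ι ℂ) * U).trace.re)) ∂haarUnitary ι := by
        rw [integral_add hi1 hi3, integral_re_trace_haarUnitary, integral_const_mul,
          integral_sub (integrable_const _) hi2, integral_re_trace_sq_haarUnitary]
        simp
    _ ≤ _ := by
        refine integral_mono_ae (hi1.add hi3) (integrable_re_trace_cayleyPath θ) ?_
        filter_upwards [compl_mem_ae_iff.2 haarUnitary_compl_genericUnitary] with H hH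
        exact re_trace_cayleyPath_ge h0 h1 (not_not.1 hH)

end TraceBound

/-! ### Domination of product measures -/

section ProductDomination

/-- Comparison on boxes suffices, because the product outer measure is the largest one bounded by
the products on boxes. -/
theorem prod_smul_pi_le {ι : Type*} [Fintype ι] {X : ι → Type*} [∀ i, MeasurableSpace (X i)]
    {μ ν : ∀ i, Measure (X i)} [∀ i, SigmaFinite (μ i)] (c : ι → ℝ≥0∞)
    (h : ∀ i, c i • μ i ≤ ν i) : (∏ i, c i) • Measure.pi μ ≤ Measure.pi ν := by
  have h1 : (∏ i, c i) • (Measure.pi μ).toOuterMeasure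
      ≤ OuterMeasure.pi fun i => (ν i).toOuterMeasure := by
    refine OuterMeasure.le_pi.2 fun s _ => ?_
    rw [smul_apply, smul_eq_mul, Measure.coe_toOuterMeasure, Measure.pi_pi,
      ← Finset.prod_mul_distrib]
    exact Finset.prod_le_prod' fun i _ => h i (s i)
  refine Measure.le_iff.2 fun s hs => ?_
  have e : Measure.pi ν s = OuterMeasure.pi (fun i => (ν i).toOuterMeasure) s := by
    rw [Measure.pi_def, toMeasure_apply _ _ hs]
  rw [e]
  exact h1 s

end ProductDomination

/-! ### The indistinguishability game -/

namespace Scheme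

variable {A : ℕ → Architecture} {p : ℕ → ℕ} {S : Scheme A p} {sec : ℕ} {T : Finset (Fin (p sec))}

attribute [instance] Adversary.isMarkov

/-- The law of the adversary's guess upon the shares of `circ b`. -/
noncomputable def Adversary.guessLaw (𝒜 : S.Adversary sec T) (b : Bool) : Measure Bool :=
  ((S.gen sec (𝒜.circ b)).map T.restrict).bind 𝒜.guess

theorem Adversary.game_singleton (𝒜 : S.Adversary sec T) (y : Bool) :
    𝒜.game {y} = 2⁻¹ * (𝒜.guessLaw false {y} + 𝒜.guessLaw true {!y}) := by
  have h1 : (fun b' => xor false b') ⁻¹' {y} = {y} := by ext b; simp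
  have h2 : (fun b' => xor true b') ⁻¹' {y} = {!y} := by ext b; cases b <;> cases y <;> simp
  unfold game
  rw [Measure.smul_apply, Fintype.sum_bool, Measure.add_apply,
    Measure.map_apply (measurable_of_countable _) (measurableSet_singleton _),
    Measure.map_apply (measurable_of_countable _) (measurableSet_singleton _), h1, h2, add_comm]
  rfl

theorem measure_bool_add (μ : Measure Bool) [IsProbabilityMeasure μ] (y : Bool) :
    μ {y} + μ {!y} = 1 := by
  have : ({!y} : Set Bool) = {y}ᶜ := by ext b; cases b <;> cases y <;> simp
  rw [this, prob_add_prob_compl (measurableSet_singleton _)]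

theorem measureReal_bool_add (μ : Measure Bool) [IsProbabilityMeasure μ] (y : Bool) :
    μ.real {y} + μ.real {!y} = 1 := by
  have : ({!y} : Set Bool) = {y}ᶜ := by ext b; cases b <;> cases y <;> simp
  rw [this, probReal_add_probReal_compl (measurableSet_singleton _)]

theorem Adversary.isProbabilityMeasure_guessLaw (𝒜 : S.Adversary sec T) {b : Bool}
    (h : IsProbabilityMeasure (S.gen sec (𝒜.circ b))) :
    IsProbabilityMeasure (𝒜.guessLaw b) := by
  have : IsProbabilityMeasure ((S.gen sec (𝒜.circ b)).map T.restrict) :=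
    Measure.isProbabilityMeasure_map (by fun_prop)
  unfold guessLaw
  infer_instance

theorem Adversary.isProbabilityMeasure_game (𝒜 : S.Adversary sec T)
    (h : ∀ b, IsProbabilityMeasure (S.gen sec (𝒜.circ b))) :
    IsProbabilityMeasure 𝒜.game := by
  have hb := fun b => 𝒜.isProbabilityMeasure_guessLaw (h b)
  refine ⟨?_⟩
  have hu : (Set.univ : Set Bool) = {false} ∪ {true} := by ext b; cases b <;> simp
  rw [hu, measure_union (by simp) (measurableSet_singleton _), game_singleton, game_singleton,
    ← mul_add]
  have h1 := measure_bool_add (𝒜.guessLaw false) false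
  have h2 := measure_bool_add (𝒜.guessLaw true) true
  simp only [Bool.not_false, Bool.not_true] at *
  rw [add_add_add_comm, h1, h2, one_add_one_eq_two, ENNReal.inv_mul_cancel] <;> norm_num

theorem Adversary.advantage_le_half (𝒜 : S.Adversary sec T)
    (h : ∀ b, IsProbabilityMeasure (S.gen sec (𝒜.circ b))) : 𝒜.advantage ≤ 1 / 2 := by
  have := 𝒜.isProbabilityMeasure_game h
  unfold advantage
  have h0 : 0 ≤ 𝒜.game.real {false} := measureReal_nonneg
  have h1 : 𝒜.game.real {false} ≤ 1 := measureReal_le_one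
  rw [abs_le]; constructor <;> linarith

/-- If a fixed law dominates the multiples by `ρ` of the laws of the shares of all circuits, then
the advantage is at most `1 - ρ`. -/
theorem Adversary.advantage_le_of_smul_le (𝒜 : S.Adversary sec T)
    (h : ∀ b, IsProbabilityMeasure (S.gen sec (𝒜.circ b)))
    (Q : Measure (∀ i : T, S.Share sec i)) [IsProbabilityMeasure Q] {ρ : ℝ} (hρ0 : 0 ≤ ρ)
    (hρ1 : ρ ≤ 1)
    (hQ : ∀ b, ENNReal.ofReal ρ • (S.gen sec (𝒜.circ b)).map T.restrict ≤ Q) :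
    𝒜.advantage ≤ 1 - ρ := by
  have hP := 𝒜.isProbabilityMeasure_game h
  have hle : ∀ b y, ENNReal.ofReal ρ * 𝒜.guessLaw b {y} ≤ (Q.bind 𝒜.guess) {y} := by
    intro b y
    unfold guessLaw
    rw [Measure.bind_apply (measurableSet_singleton _) 𝒜.guess.aemeasurable,
      Measure.bind_apply (measurableSet_singleton _) 𝒜.guess.aemeasurable, ← smul_eq_mul,
      ← lintegral_smul_measure]
    exact lintegral_mono' (hQ b) le_rfl
  -- Both guess laws are replaced by the single one under `Q`; the events `{y}` and `{!y}` then have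
  -- total mass `1`.
  have hgame : ∀ y, ρ * 𝒜.game.real {y} ≤ 1 / 2 := by
    intro y
    have h1 : ENNReal.ofReal ρ * 𝒜.game {y} ≤ 2⁻¹ := by
      rw [game_singleton, mul_left_comm, mul_add]
      calc _ ≤ (2 : ℝ≥0∞)⁻¹ * ((Q.bind 𝒜.guess) {y} + (Q.bind 𝒜.guess) {!y}) := by
            gcongr <;> exact hle _ _
        _ = 2⁻¹ := by rw [measure_bool_add, mul_one]
    have h2 := ENNReal.toReal_mono (by simp) h1
    rw [ENNReal.toReal_mul, ENNReal.toReal_ofReal hρ0] at h2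
    simpa [Measure.real] using h2
  have hf := hgame false
  have ht := hgame true
  have hs := measureReal_bool_add 𝒜.game false
  have hf1 : 𝒜.game.real {false} ≤ 1 := measureReal_le_one
  have ht1 : 𝒜.game.real {true} ≤ 1 := measureReal_le_one
  simp only [Bool.not_false] at hs
  unfold advantage
  rw [abs_le]
  -- For either outcome of probability `q`, `q - 1/2 ≤ (1 - ρ) q ≤ 1 - ρ`; the two outcomes give the
  -- two signs.
  constructor <;> nlinarith

end Scheme

/-! ### Randomized guesses with a prescribed bias -/

section Coin

variable {X : Type*} [MeasurableSpace X]

/-- The randomized guess that is `false` with probability `(1 + g) / 2`. -/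
noncomputable def coinKernel (g : X → ℝ) (hg : Measurable g) : Kernel X Bool where
  toFun x := ENNReal.ofReal ((1 + g x) / 2) • Measure.dirac false
    + ENNReal.ofReal ((1 - g x) / 2) • Measure.dirac true
  measurable' := by
    refine Measure.measurable_of_measurable_coe _ fun s hs => ?_
    simp only [Measure.add_apply, Measure.smul_apply, smul_eq_mul]
    fun_prop

theorem coinKernel_false (g : X → ℝ) (hg : Measurable g) (x : X) :
    coinKernel g hg x {false} = ENNReal.ofReal ((1 + g x) / 2) := by
  simp [coinKernel]

theorem coinKernel_true (g : X → ℝ) (hg : Measurable g) (x : X) :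
    coinKernel g hg x {true} = ENNReal.ofReal ((1 - g x) / 2) := by
  simp [coinKernel]

theorem isMarkovKernel_coinKernel {g : X → ℝ} (hg : Measurable g) (h : ∀ x, |g x| ≤ 1) :
    IsMarkovKernel (coinKernel g hg) := by
  refine ⟨fun x => ⟨?_⟩⟩
  have hx := abs_le.1 (h x)
  simp only [coinKernel, Kernel.coe_mk, Measure.add_apply, Measure.smul_apply, smul_eq_mul,
    measure_univ, mul_one]
  rw [← ENNReal.ofReal_add (by linarith) (by linarith)]
  norm_num
  ring_nf

theorem integrable_of_abs_le_one {g : X → ℝ} (hg : Measurable g) (h : ∀ x, |g x| ≤ 1)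
    (L : Measure X) [IsFiniteMeasure L] : Integrable g L :=
  Integrable.of_bound (C := 1) hg.aestronglyMeasurable (Eventually.of_forall h)

theorem bind_coinKernel_false {g : X → ℝ} (hg : Measurable g) (h : ∀ x, |g x| ≤ 1)
    (L : Measure X) [IsProbabilityMeasure L] :
    (L.bind (coinKernel g hg)).real {false} = (1 + ∫ x, g x ∂L) / 2 := by
  rw [Measure.real, Measure.bind_apply (measurableSet_singleton _) (Kernel.aemeasurable _)]
  simp_rw [coinKernel_false]
  have hi : Integrable g L := integrable_of_abs_le_one hg h L
  rw [← integral_eq_lintegral_of_nonneg_ae, integral_div, integral_add (integrable_const _) hi]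
  · simp
  · refine Eventually.of_forall fun x => ?_
    have := abs_le.1 (h x)
    simp only [Pi.zero_apply]
    linarith
  · fun_prop

theorem bind_coinKernel_true {g : X → ℝ} (hg : Measurable g) (h : ∀ x, |g x| ≤ 1)
    (L : Measure X) [IsProbabilityMeasure L] :
    (L.bind (coinKernel g hg)).real {true} = (1 - ∫ x, g x ∂L) / 2 := by
  rw [Measure.real, Measure.bind_apply (measurableSet_singleton _) (Kernel.aemeasurable _)]
  simp_rw [coinKernel_true]
  have hi : Integrable g L := integrable_of_abs_le_one hg h L
  rw [← integral_eq_lintegral_of_nonneg_ae, integral_div, integral_sub (integrable_const _) hi]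
  · simp
  · refine Eventually.of_forall fun x => ?_
    have := abs_le.1 (h x)
    simp only [Pi.zero_apply]
    linarith
  · fun_prop

end Coin

/-! ### Advantage against the Cayley-path scheme -/

section CayleyScheme

instance (A : Architecture) : IsProbabilityMeasure (haarCircuit A) := by
  unfold haarCircuit; infer_instance

theorem measurable_cayleyCircuit {A : Architecture} (C : A.Circuit) (θ : ℝ) :
    Measurable fun H : A.Circuit => cayleyCircuit C H θ :=
  measurable_pi_lambda _ fun k =>
    ((measurable_cayleyPath θ).const_mul (C k)).comp (measurable_pi_apply k)

theorem card_site_le (A : Architecture) (k : Fin A.m) :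
    Fintype.card (A.site k → Fin 2) ≤ 4 := by
  rcases A.site_card k with h | h <;> simp [h]

/-- The gates of a share are independent, and a gate has size at most `4`, so each costs at most the
exponent `2 · 4² = 32`. -/
theorem map_cayleyCircuit_le {A : Architecture} (C : A.Circuit) {θ : ℝ} (h0 : 0 < θ) (h1 : θ ≤ 1) :
    ENNReal.ofReal (θ ^ (32 * A.m)) • (haarCircuit A).map (fun H => cayleyCircuit C H θ)
      ≤ haarCircuit A := by
  have hmeas : ∀ k, Measurable fun H : Gate (A.site k) => C k * cayleyPath θ H :=
    fun k => (measurable_cayleyPath θ).const_mul (C k)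
  have hp : ∀ k, IsProbabilityMeasure
      ((haarUnitary (A.site k → Fin 2)).map fun H => C k * cayleyPath θ H) :=
    fun k => Measure.isProbabilityMeasure_map (hmeas k).aemeasurable
  have e : (haarCircuit A).map (fun H => cayleyCircuit C H θ)
      = Measure.pi fun k => (haarUnitary (A.site k → Fin 2)).map fun H => C k * cayleyPath θ H :=
    Measure.pi_map_pi fun k => (hmeas k).aemeasurable
  have h := prod_smul_pi_le (fun _ : Fin A.m => ENNReal.ofReal θ ^ 32)
    (μ := fun k => (haarUnitary (A.site k → Fin 2)).map fun H => C k * cayleyPath θ H)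
    (ν := fun k => haarUnitary (A.site k → Fin 2)) fun k => by
      refine le_trans ?_ (map_cayleyPath_le h0 h1 (C k))
      refine Measure.le_iff.2 fun s _ => ?_
      rw [Measure.smul_apply, Measure.smul_apply, smul_eq_mul, smul_eq_mul]
      gcongr ?_ * _
      refine pow_le_pow_right_of_le_one' (ENNReal.ofReal_le_one.2 h1) ?_
      have := card_site_le A k
      calc 2 * Fintype.card (A.site k → Fin 2) ^ 2 ≤ 2 * 4 ^ 2 := by gcongr
        _ = 32 := by norm_num
  rw [e, ENNReal.ofReal_pow h0.le, pow_mul]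
  simp only [Finset.prod_const, Finset.card_univ, Fintype.card_fin] at h
  exact h

variable {A : ℕ → Architecture} {p : ℕ → ℕ} {Δ : ℕ → ℝ} {ℓ : ℕ → ℕ}

theorem measurable_shares (sec : ℕ) (C : (A sec).Circuit) :
    Measurable fun (H : (A sec).Circuit) (i : Fin (p sec)) =>
      cayleyCircuit C H (node (Δ sec) i) :=
  measurable_pi_lambda _ fun _ => measurable_cayleyCircuit C _

theorem isProbabilityMeasure_gen (sec : ℕ) (C : (A sec).Circuit) :
    IsProbabilityMeasure ((cayleyScheme A p Δ ℓ).gen sec C) :=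
  Measure.isProbabilityMeasure_map (measurable_shares sec C).aemeasurable

theorem map_restrict_gen (sec : ℕ) (C : (A sec).Circuit) (i : Fin (p sec)) :
    ((cayleyScheme A p Δ ℓ).gen sec C).map ({i} : Finset (Fin (p sec))).restrict
      = (haarCircuit (A sec)).map fun H (_ : ({i} : Finset (Fin (p sec)))) =>
          cayleyCircuit C H (node (Δ sec) i) := by
  refine (Measure.map_map (by fun_prop) (measurable_shares sec C)).trans ?_
  congr 1
  funext H j
  change cayleyCircuit C H (node (Δ sec) (j : Fin (p sec))) = _
  rw [Finset.mem_singleton.1 j.2]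

theorem advantage_le (sec : ℕ) (i : Fin (p sec)) (h0 : 0 ≤ Δ sec)
    (h1 : ((i : ℝ) + 1) * Δ sec ≤ 1) (hm : 1 ≤ (A sec).m)
    (𝒜 : (cayleyScheme A p Δ ℓ).Adversary sec {i}) :
    𝒜.advantage ≤ 32 * ((A sec).m * (((i : ℝ) + 1) * Δ sec)) := by
  set ε := ((i : ℝ) + 1) * Δ sec with hε
  have hε0 : 0 ≤ ε := by positivity
  have hm' : (1 : ℝ) ≤ (A sec).m := by exact_mod_cast hm
  have hgen := fun b => isProbabilityMeasure_gen (p := p) (Δ := Δ) (ℓ := ℓ) sec (𝒜.circ b)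
  -- At `ε = 1` the node is `0`, where the domination does not apply; the trivial bound `1/2` is
  -- enough because `m ≥ 1`.
  rcases eq_or_lt_of_le h1 with h | hlt
  · have := 𝒜.advantage_le_half hgen
    rw [h]; linarith
  · have hθ : node (Δ sec) i = 1 - ε := rfl
    have hrep : Measurable fun (C : (A sec).Circuit) (_ : ({i} : Finset (Fin (p sec)))) => C :=
      measurable_pi_lambda _ fun _ => measurable_id
    let Q : Measure (∀ j : ({i} : Finset (Fin (p sec))), (cayleyScheme A p Δ ℓ).Share sec j) :=
      (haarCircuit (A sec)).map fun C _ => C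
    have hprob : IsProbabilityMeasure Q := Measure.isProbabilityMeasure_map hrep.aemeasurable
    have hθ0 : 0 < 1 - ε := by linarith
    have hθ1 : 1 - ε ≤ 1 := by linarith
    have h := 𝒜.advantage_le_of_smul_le hgen Q
        (ρ := (1 - ε) ^ (32 * (A sec).m)) (by positivity) (pow_le_one₀ hθ0.le hθ1) fun b => by
          rw [map_restrict_gen, hθ]
          have := Measure.map_mono (map_cayleyCircuit_le (𝒜.circ b) hθ0 hθ1) hrep
          rwa [Measure.map_smul, Measure.map_map hrep (measurable_cayleyCircuit _ _)] at this
    -- Bernoulli's inequality: `(1 - ε)^(32m) ≥ 1 - 32mε`.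
    have hB := one_add_mul_le_pow (a := -ε) (by linarith) (32 * (A sec).m)
    push_cast at hB
    rw [← sub_eq_add_neg] at hB
    linarith

/-- The normalized real part of the trace of the first gate. -/
noncomputable def firstGateTrace {B : Architecture} (hm : 1 ≤ B.m) (C : B.Circuit) : ℝ :=
  (C ⟨0, hm⟩ : Matrix (B.site ⟨0, hm⟩ → Fin 2) (B.site ⟨0, hm⟩ → Fin 2) ℂ).trace.re
    / Fintype.card (B.site ⟨0, hm⟩ → Fin 2)

theorem measurable_firstGateTrace {B : Architecture} (hm : 1 ≤ B.m) :
    Measurable (firstGateTrace hm) :=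
  (continuous_re_trace.measurable.comp (measurable_pi_apply _)).div_const _

theorem abs_firstGateTrace_le {B : Architecture} (hm : 1 ≤ B.m) (C : B.Circuit) :
    |firstGateTrace hm C| ≤ 1 := by
  unfold firstGateTrace
  rw [abs_div, Nat.abs_cast]
  exact div_le_one_of_le₀ (abs_re_trace_le _) (by positivity)

theorem measurable_share_firstGateTrace (sec : ℕ) (i : Fin (p sec)) (hm : 1 ≤ (A sec).m) :
    Measurable fun s : (∀ j : ({i} : Finset (Fin (p sec))), (cayleyScheme A p Δ ℓ).Share sec j) =>
      firstGateTrace hm (s ⟨i, Finset.mem_singleton_self i⟩) :=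
  (measurable_firstGateTrace hm).comp (measurable_pi_apply _)

/-- The adversary that distinguishes the circuits with gates `1` and `-1` by the trace of the first
gate of its share. -/
noncomputable def traceAdversary (sec : ℕ) (i : Fin (p sec)) (hm : 1 ≤ (A sec).m) :
    (cayleyScheme A p Δ ℓ).Adversary sec {i} where
  circ b := fun _ => if b then -1 else 1
  guess := coinKernel _ (measurable_share_firstGateTrace sec i hm)
  isMarkov := isMarkovKernel_coinKernel _ fun _ => abs_firstGateTrace_le hm _

theorem integral_re_trace_gate {B : Architecture} (k : Fin B.m) (θ : ℝ) :
    ∫ H : B.Circuit, (cayleyPath θ (H k) : Matrix (B.site k → Fin 2) _ ℂ).trace.re ∂haarCircuit B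
      = ∫ U, (cayleyPath θ U : Matrix (B.site k → Fin 2) _ ℂ).trace.re
          ∂haarUnitary (B.site k → Fin 2) := by
  have hmp : MeasurePreserving (Function.eval k) (haarCircuit B)
      (haarUnitary (B.site k → Fin 2)) :=
    measurePreserving_eval (fun k => haarUnitary (B.site k → Fin 2)) k
  rw [← hmp.map_eq]
  exact (integral_map hmp.measurable.aemeasurable
    (continuous_re_trace.measurable.comp (measurable_cayleyPath θ)).aestronglyMeasurable).symm

theorem integral_firstGateTrace {B : Architecture} (hm : 1 ≤ B.m) {θ : ℝ} (h0 : 0 ≤ θ)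
    (h1 : θ ≤ 1) : (1 - θ ^ 2) / 4 ≤
      ∫ H, firstGateTrace hm (cayleyCircuit (fun _ => 1) H θ) ∂haarCircuit B := by
  have hd : (0 : ℝ) < Fintype.card (B.site ⟨0, hm⟩ → Fin 2) :=
    Nat.cast_pos.2 Fintype.card_pos
  have e : ∀ H : B.Circuit, firstGateTrace hm (cayleyCircuit (fun _ => 1) H θ)
      = (cayleyPath θ (H ⟨0, hm⟩) : Matrix (B.site ⟨0, hm⟩ → Fin 2) _ ℂ).trace.re
        / Fintype.card (B.site ⟨0, hm⟩ → Fin 2) := fun H => by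
    rw [firstGateTrace, cayleyCircuit, one_mul]
  simp_rw [e]
  rw [integral_div, integral_re_trace_gate, le_div_iff₀ hd]
  exact integral_re_trace_cayleyPath_ge h0 h1

theorem integral_firstGateTrace_neg {B : Architecture} (hm : 1 ≤ B.m) (θ : ℝ) :
    ∫ H, firstGateTrace hm (cayleyCircuit (fun _ => -1) H θ) ∂haarCircuit B
      = -∫ H, firstGateTrace hm (cayleyCircuit (fun _ => 1) H θ) ∂haarCircuit B := by
  rw [← integral_neg]
  congr 1
  funext H
  rw [firstGateTrace, firstGateTrace, cayleyCircuit, cayleyCircuit, one_mul, neg_one_mul,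
    Unitary.coe_neg, Matrix.trace_neg, Complex.neg_re, neg_div]

theorem le_advantage_traceAdversary (sec : ℕ) (i : Fin (p sec)) (hm : 1 ≤ (A sec).m)
    (h0 : 0 ≤ Δ sec) (h1 : ((i : ℝ) + 1) * Δ sec ≤ 1) :
    1 / 8 * (((i : ℝ) + 1) * Δ sec)
      ≤ (traceAdversary (Δ := Δ) (ℓ := ℓ) sec i hm).advantage := by
  set 𝒜 := traceAdversary (Δ := Δ) (ℓ := ℓ) sec i hm with h𝒜
  have hg := measurable_share_firstGateTrace (Δ := Δ) (ℓ := ℓ) sec i hm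
  have hgen := fun b => isProbabilityMeasure_gen (p := p) (Δ := Δ) (ℓ := ℓ) sec (𝒜.circ b)
  have hL : ∀ b, IsProbabilityMeasure (((cayleyScheme A p Δ ℓ).gen sec (𝒜.circ b)).map
      ({i} : Finset (Fin (p sec))).restrict) :=
    fun b => Measure.isProbabilityMeasure_map (by fun_prop)
  have hint : ∀ b, ∫ s, firstGateTrace hm (s ⟨i, Finset.mem_singleton_self i⟩)
      ∂(((cayleyScheme A p Δ ℓ).gen sec (𝒜.circ b)).map ({i} : Finset (Fin (p sec))).restrict)
      = ∫ H, firstGateTrace hm (cayleyCircuit (𝒜.circ b) H (node (Δ sec) i))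
        ∂haarCircuit (A sec) := by
    intro b
    rw [map_restrict_gen]
    exact integral_map (measurable_pi_lambda _ fun _ =>
      measurable_cayleyCircuit _ _).aemeasurable hg.aestronglyMeasurable
  have hf : (𝒜.guessLaw false).real {false} = (1 + ∫ H,
      firstGateTrace hm (cayleyCircuit (𝒜.circ false) H (node (Δ sec) i))
        ∂haarCircuit (A sec)) / 2 := by
    rw [← hint]
    exact bind_coinKernel_false hg (fun _ => abs_firstGateTrace_le hm _) _
  have ht : (𝒜.guessLaw true).real {true} = (1 - ∫ H,
      firstGateTrace hm (cayleyCircuit (𝒜.circ true) H (node (Δ sec) i))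
        ∂haarCircuit (A sec)) / 2 := by
    rw [← hint]
    exact bind_coinKernel_true hg (fun _ => abs_firstGateTrace_le hm _) _
  have hct : 𝒜.circ true = fun _ => -1 := by simp [h𝒜, traceAdversary]
  have hcf : 𝒜.circ false = fun _ => 1 := by simp [h𝒜, traceAdversary]
  rw [hct, integral_firstGateTrace_neg] at ht
  rw [hcf] at hf
  set ε := ((i : ℝ) + 1) * Δ sec with hε
  have hε0 : 0 ≤ ε := by positivity
  have hθ : node (Δ sec) i = 1 - ε := rfl
  have hI := integral_firstGateTrace hm (θ := node (Δ sec) i) (by linarith) (by linarith)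
  have hgame : 𝒜.game.real {false} = 2⁻¹ * ((𝒜.guessLaw false).real {false}
      + (𝒜.guessLaw true).real {true}) := by
    have := 𝒜.isProbabilityMeasure_guessLaw (hgen false)
    have := 𝒜.isProbabilityMeasure_guessLaw (hgen true)
    rw [Measure.real, 𝒜.game_singleton, ENNReal.toReal_mul,
      ENNReal.toReal_add (measure_ne_top _ _) (measure_ne_top _ _)]
    simp [Measure.real]
  unfold Scheme.Adversary.advantage
  rw [hgame, hf, ht]
  refine le_trans ?_ (le_abs_self _)
  rw [hθ] at hI ⊢
  -- The advantage is at least half the mean trace, which is at least `(1 - θ²)/4 = ε(2 - ε)/4 ≥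
  -- ε/4` because `ε ≤ 1`.
  nlinarith

/-- The uniform bound `1/2` makes the real supremum meaningful; an unbounded one would be `0` by
convention. -/
theorem le_optAdvantage {sec : ℕ} {i : Fin (p sec)}
    (𝒜 : (cayleyScheme A p Δ ℓ).Adversary sec {i}) :
    𝒜.advantage ≤ (cayleyScheme A p Δ ℓ).optAdvantage sec {i} :=
  le_ciSup (f := fun 𝒜 : (cayleyScheme A p Δ ℓ).Adversary sec {i} => 𝒜.advantage)
    ⟨1 / 2, by
      rintro _ ⟨ℬ, rfl⟩
      exact ℬ.advantage_le_half fun b => isProbabilityMeasure_gen sec _⟩ 𝒜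

theorem optAdvantage_bounds (sec : ℕ) (i : Fin (p sec)) (hm : 1 ≤ (A sec).m)
    (h0 : 0 ≤ Δ sec) (h1 : ((i : ℝ) + 1) * Δ sec ≤ 1) :
    1 / 8 * (((i : ℝ) + 1) * Δ sec) ≤ (cayleyScheme A p Δ ℓ).optAdvantage sec {i} ∧
      (cayleyScheme A p Δ ℓ).optAdvantage sec {i}
        ≤ 32 * ((A sec).m * (((i : ℝ) + 1) * Δ sec)) :=
  ⟨(le_advantage_traceAdversary sec i hm h0 h1).trans (le_optAdvantage _),
    Real.iSup_le (fun 𝒜 => advantage_le sec i h0 h1 hm 𝒜) (by positivity)⟩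

theorem InversePoly.eventually_nonneg (hΔ : InversePoly Δ) : ∀ᶠ sec in atTop, 0 ≤ Δ sec := by
  obtain ⟨k, hk⟩ := hΔ
  filter_upwards [hk] with sec h
  exact le_trans (by positivity) h.1

/-- After multiplication by `λ^k` with `λ^{-k} ≤ Δ`, the function stays above `c` instead of tending
to `0`. -/
theorem not_negligible_of_le {f : ℕ → ℝ} {c : ℝ} (hc : 0 < c) (hΔ : InversePoly Δ)
    (h : ∀ᶠ sec in atTop, c * Δ sec ≤ f sec) : ¬ Negligible f := by
  intro hf
  obtain ⟨k, hk⟩ := hΔ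
  have hlim := hf k
  have hev := hlim.eventually (gt_mem_nhds hc)
  obtain ⟨sec, ⟨⟨h1, h2⟩, h3⟩, h4⟩ :=
    (((hk.and h).and hev).and (eventually_ge_atTop 1)).exists
  have hpos : (0 : ℝ) < (sec : ℝ) ^ k := by
    have : (0 : ℝ) < sec := by exact_mod_cast h4
    positivity
  have h5 : c * (1 / (sec : ℝ) ^ k) ≤ f sec := (mul_le_mul_of_nonneg_left h1.1 hc.le).trans h2
  have h6 := mul_le_mul_of_nonneg_left h5 hpos.le
  have h7 : (sec : ℝ) ^ k * (c * (1 / (sec : ℝ) ^ k)) = c := by field_simp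
  simp only at h3
  linarith

theorem not_negligible_traceAdversary (hm : ∀ sec, 1 ≤ (A sec).m) (hΔ : InversePoly Δ)
    (i : (sec : ℕ) → Fin (p sec)) (hi : ∀ᶠ sec in atTop, ((i sec : ℝ) + 1) * Δ sec ≤ 1) :
    ¬ Negligible fun sec =>
      (traceAdversary (Δ := Δ) (ℓ := ℓ) sec (i sec) (hm sec)).advantage := by
  refine not_negligible_of_le (c := 1 / 8) (by norm_num) hΔ ?_
  filter_upwards [hi, hΔ.eventually_nonneg] with sec h1 h0
  refine le_trans ?_ (le_advantage_traceAdversary sec (i sec) (hm sec) h0 h1)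
  have : 0 ≤ ((i sec : ℕ) : ℝ) * Δ sec := by positivity
  linarith

theorem not_secure_one (hm : ∀ sec, 1 ≤ (A sec).m) (hp : ∀ sec, (A sec).m ≤ p sec)
    (hΔ : InversePoly Δ) : ¬ (cayleyScheme A p Δ ℓ).Secure 1 := by
  intro h
  -- Index `0` is party number `1`; its node `1 - Δ` is nonnegative for large parameters because `Δ
  -- ≤ 1` there.
  let i : (sec : ℕ) → Fin (p sec) := fun sec => ⟨0, (hm sec).trans (hp sec)⟩
  refine not_negligible_traceAdversary (ℓ := ℓ) hm hΔ i ?_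
    (h (fun sec => {i sec}) (fun sec => by simp) _)
  obtain ⟨k, hk⟩ := hΔ
  filter_upwards [hk] with sec h
  simpa [i] using h.2

theorem optAdvantage_isTheta (hm : ∀ sec, 1 ≤ (A sec).m) (hΔ : InversePoly Δ) {M : ℕ}
    (hM : ∀ sec, (A sec).m ≤ M) (i : ℕ) (hi : ∀ sec, i < p sec)
    (h1 : ∀ᶠ sec in atTop, ((i : ℝ) + 1) * Δ sec ≤ 1) :
    (fun sec => (cayleyScheme A p Δ ℓ).optAdvantage sec {⟨i, hi sec⟩})
      =Θ[atTop] fun sec => ((A sec).m : ℝ) * Δ sec := by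
  constructor
  · refine IsBigO.of_bound (32 * ((i : ℝ) + 1)) ?_
    filter_upwards [h1, hΔ.eventually_nonneg] with sec h1 h0
    obtain ⟨hl, hu⟩ := optAdvantage_bounds (ℓ := ℓ) sec ⟨i, hi sec⟩ (hm sec) h0 h1
    have hε : 0 ≤ 1 / 8 * (((i : ℝ) + 1) * Δ sec) := by positivity
    rw [Real.norm_of_nonneg (hε.trans hl), Real.norm_of_nonneg (by positivity)]
    refine hu.trans (le_of_eq ?_)
    ring
  -- The lower bound on the advantage has no factor `m`; the bound `M` supplies it.
  · refine IsBigO.of_bound (8 * (M : ℝ)) ?_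
    filter_upwards [h1, hΔ.eventually_nonneg] with sec h1 h0
    obtain ⟨hl, hu⟩ := optAdvantage_bounds (ℓ := ℓ) sec ⟨i, hi sec⟩ (hm sec) h0 h1
    have hε : 0 ≤ 1 / 8 * (((i : ℝ) + 1) * Δ sec) := by positivity
    rw [Real.norm_of_nonneg (hε.trans hl), Real.norm_of_nonneg (by positivity)]
    have hMr : ((A sec).m : ℝ) ≤ M := by exact_mod_cast hM sec
    have hl' : Δ sec ≤ 8 * (cayleyScheme A p Δ ℓ).optAdvantage sec {⟨i, hi sec⟩} := by
      have : 0 ≤ (i : ℝ) * Δ sec := by positivity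
      simp only at hl
      linarith
    calc ((A sec).m : ℝ) * Δ sec ≤ M * (8 * _) := by gcongr
      _ = _ := by ring

end CayleyScheme

end QFSS

theorem mainTheorem3 :
    ∃ c K : ℝ, 0 < c ∧ 0 < K ∧
      ∀ (A : ℕ → QFSS.Architecture) (p : ℕ → ℕ) (Δ : ℕ → ℝ) (ℓ : ℕ → ℕ) (η : ℕ → ℝ),
        (∀ sec, 1 ≤ (A sec).m) → (∀ sec, (A sec).m ≤ p sec) → QFSS.InversePoly Δ →
        -- the optimal advantage from one share, with absolute constants
        (∀ (sec : ℕ) (i : Fin (p sec)), 0 ≤ Δ sec → ((i : ℝ) + 1) * Δ sec ≤ 1 →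
          c * (((i : ℝ) + 1) * Δ sec) ≤ (QFSS.cayleyScheme A p Δ ℓ).optAdvantage sec {i} ∧
          (QFSS.cayleyScheme A p Δ ℓ).optAdvantage sec {i} ≤
            K * ((A sec).m * (((i : ℝ) + 1) * Δ sec))) ∧
        -- for a bounded number of gates, it is of order `m Δ`
        ((∃ M : ℕ, ∀ sec, (A sec).m ≤ M) →
          ∀ (i : ℕ) (hi : ∀ sec, i < p sec), (∀ᶠ sec in atTop, ((i : ℝ) + 1) * Δ sec ≤ 1) →
            (fun sec => (QFSS.cayleyScheme A p Δ ℓ).optAdvantage sec {⟨i, hi sec⟩})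
              =Θ[atTop] fun sec => ((A sec).m : ℝ) * Δ sec) ∧
        -- every single party can break the scheme
        (∀ i : (sec : ℕ) → Fin (p sec), (∀ᶠ sec in atTop, ((i sec : ℝ) + 1) * Δ sec ≤ 1) →
          ∃ 𝒜 : (sec : ℕ) → (QFSS.cayleyScheme A p Δ ℓ).Adversary sec {i sec},
            ¬ QFSS.Negligible fun sec => (𝒜 sec).advantage) ∧
        ¬ (QFSS.cayleyScheme A p Δ ℓ).Secure 1 ∧
        ¬ (QFSS.cayleyScheme A p Δ ℓ).IsQFSS 1 ℓ (fun sec => (A sec).m * ℓ sec) η := by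
  refine ⟨1 / 8, 32, by norm_num, by norm_num, fun A p Δ ℓ η hm hp hΔ => ⟨?_, ?_, ?_, ?_, ?_⟩⟩
  · exact fun sec i h0 h1 => QFSS.optAdvantage_bounds sec i (hm sec) h0 h1
  · rintro ⟨M, hM⟩ i hi h1
    exact QFSS.optAdvantage_isTheta hm hΔ hM i hi h1
  · exact fun i hi => ⟨_, QFSS.not_negligible_traceAdversary hm hΔ i hi⟩
  · exact QFSS.not_secure_one hm hp hΔ
  · exact fun h => QFSS.not_secure_one hm hp hΔ h.secure
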